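/- Setting. Let $n\ge 0$, $d\ge1$, $k,M\ge 0$ be integers, $Z\in\mathbb{R}^{n\times d}$, $\nu>0$, $\sigma>0$, and consider the Gaussian linear model $P_\theta=\mathcal N(Z\theta,\nu^2 I_n)$, $\theta\in\mathbb{R}^d$, with Lebesgue density $f(x;\theta)$. Let $R:\mathbb{R}^d\to\mathbb{R}$ be twice differentiable, and suppose that for some $c>0$ $$\tfrac1{\nu^2}Z^\top Z+\nabla^2R(\theta)\succ c\,I_d\qquad\text{for all }\theta\in\mathbb{R}^d .$$ Let $A\in\mathbb{R}^{k\times d}$ have rows $A_1,\dots,A_k$ and let $b\in\mathbb{R}^k$ be such that $\{\theta:A\theta\le b\}$ (entrywise inequality) is nonempty. Put $\mathcal L(\theta;x)=-\log f(x;\theta)+R(\theta)$ and $\mathcal L(\theta;x,w)=\mathcal L(\theta;x)+\sigma w^\top\theta$, let $\hat\theta(x,w)$ be the (unique) minimizer of $\theta\mapsto\mathcal L(\theta;x,w)$ subject to $A\theta\le b$, and put $\hat g(x,w)=\nabla_\theta\mathcal L(\hat\theta(x,w);x,w)$. For $\theta\in\mathbb{R}^d$ let $\mathcal A(\theta)=\{i:A_i^\top\theta=b_i\}$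 and let $U_{\mathcal A(\theta)}$ be a matrix whose columns form an orthonormal basis of the orthogonal complement of $\mathrm{span}\{A_i:i\in\mathcal A(\theta)\}$. Call $\theta$ a strict second-order stationary point (SSOSP) for $(x,w)$ if $A\theta\le b$; $\nabla_\theta\mathcal L(\theta;x,w)+\sum_i\lambda_iA_i=0$ for some $\lambda_i\ge0$ with $\lambda_i=0$ for $i\notin\mathcal A(\theta)$; and $U_{\mathcal A(\theta)}^\top\nabla^2_\theta\mathcal L(\theta;x,w)U_{\mathcal A(\theta)}\succ0$. Let $\mathcal X_{\theta,g}$ be the set of $x$ for which there is a $w$ such that $\theta=\hat\theta(x,w)$ is an SSOSP for $(x,w)$ and $g=\nabla_\theta\mathcal L(\theta;x,w)$, and let $p_\theta(\cdot\mid\theta,g)$ be the probability density on $\mathbb{R}^n$ proportional to $$f(x;\theta)\,\exp\Big\{-\frac{\|g-\nabla_\theta\mathcal L(\theta;x)\|^2}{2\sigma^2/d}\Big\}\,\det\big(U_{\mathcal A(\theta)}^\top\nabla_\theta^2\mathcal L(\theta;x)U_{\mathcal A(\theta)}\big)\,\mathbf 1\{x\in\mathcal X_{\theta,g}\}$$ whenever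 this can be normalized. Let $\tilde P_M(\cdot;x,\theta,g)$ be a Markov kernel from $\mathbb{R}^n\times\mathbb{R}^d\times\mathbb{R}^d$ to $(\mathbb{R}^n)^M$ such that, for all $(\theta,g)$ at which $p_\theta(\cdot\mid\theta,g)$ is defined, if $X\sim p_\theta(\cdot\mid\theta,g)$ and $(\tilde X^{(1)},\dots,\tilde X^{(M)})\mid X\sim\tilde P_M(\cdot;X,\theta,g)$, then $(X,\tilde X^{(1)},\dots,\tilde X^{(M)})$ is exchangeable (for instance, i.i.d. sampling from $p_\theta(\cdot\mid\theta,g)$). Constrained aCSS procedure. Fix $\theta_0\in\mathbb{R}^d$. Draw $X\sim P_{\theta_0}$ and, independently, $W\sim\mathcal N(0,\frac1dI_d)$; let $\hat\theta=\hat\theta(X,W)$ and $\hat g=\hat g(X,W)$. If $\hat\theta$ is not an SSOSP for $(X,W)$, put $\tilde X^{(1)}=\dots=\tilde X^{(M)}=X$; otherwise draw $(\tilde X^{(1)},\dots,\tilde X^{(M)})\mid(X,\hat\theta,\hat g)\sim\tilde P_M(\cdot;X,\hat\theta,\hat g)$. Let $d_{\mathrm{exch}}(X,\tilde X^{(1)},\dots,\tilde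 X^{(M)})$ denote the infimum of the total variation distances between the joint law of $(X,\tilde X^{(1)},\dots,\tilde X^{(M)})$ and exchangeable laws on $(\mathbb{R}^n)^{M+1}$. Theorem 3. In this setting let $r\ge0$ and $\delta\in\mathbb{R}$ be such that $\mathbb{P}\{\|\hat\theta(X,W)-\theta_0\|\le r\}\ge1-\delta$. Then $$d_{\mathrm{exch}}(X,\tilde X^{(1)},\dots,\tilde X^{(M)})\le\frac{\sigma}{2\sqrt d}\,r+\delta .$$ In particular, for every measurable $T:\mathbb{R}^n\to\mathbb{R}$ and every $\alpha\in[0,1]$, the p-value $$\mathrm{pval}=\frac1{M+1}\Big(1+\sum_{m=1}^M\mathbf 1\{T(\tilde X^{(m)})\ge T(X)\}\Big)$$ satisfies $$\mathbb{P}(\mathrm{pval}\le\alpha)\le\alpha+\frac{\sigma}{2\sqrt d}\,r+\delta .$$ -/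

import Mathlib

open MeasureTheory ProbabilityTheory
open scoped Matrix ENNReal

noncomputable section

namespace ACSS

/-! ### Total variation, exchangeability, distance to exchangeability, p-value -/

/-- Total variation distance `sup_B |μ(B) - ν(B)|` (used for probability measures only). -/
def tvDist {α : Type*} [MeasurableSpace α] (μ ν : Measure α) : ℝ :=
  ⨆ B : {B : Set α // MeasurableSet B}, |μ.real B.1 - ν.real B.1|

/-- The joint law `μ` of a finite sequence is exchangeable if it is invariant under every
permutation of the coordinates. -/
def IsExchangeable {ι α : Type*} [MeasurableSpace α] (μ : Measure (ι → α)) : Prop :=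
  ∀ π : Equiv.Perm ι, μ.map (fun v i => v (π i)) = μ

/-- Distance to exchangeability of a joint law: the infimum of the total variation distances to
exchangeable probability laws. -/
def dExch {ι α : Type*} [MeasurableSpace α] (μ : Measure (ι → α)) : ℝ :=
  ⨅ ν : {ν : Measure (ι → α) // IsProbabilityMeasure ν ∧ IsExchangeable ν}, tvDist μ ν.1

open Classical in
/-- The p-value `(1 + ∑ₘ 1{T(x̃ₘ) ≥ T(x)}) / (M + 1)`. -/
def pval {α : Type*} {M : ℕ} (T : α → ℝ) (x : α) (xt : Fin M → α) : ℝ :=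
  1 / ((M : ℝ) + 1) * (1 + ∑ m : Fin M, if T (xt m) ≥ T x then (1 : ℝ) else 0)

/-! ### Linear algebra and calculus in `ℝᵈ` -/

/-- Hessian matrix: the `(i, j)` entry is the `i`-th coordinate of the derivative of the gradient
in the direction of the `j`-th basis vector. -/
def hessian {d : ℕ} (F : EuclideanSpace ℝ (Fin d) → ℝ) (θ : EuclideanSpace ℝ (Fin d)) :
    Matrix (Fin d) (Fin d) ℝ :=
  Matrix.of fun i j => (fderiv ℝ (gradient F) θ (EuclideanSpace.single j 1)) i

/-- The `i`-th row of a matrix, as a vector of Euclidean space. -/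
def row {k d : ℕ} (A : Matrix (Fin k) (Fin d) ℝ) (i : Fin k) : EuclideanSpace ℝ (Fin d) :=
  WithLp.toLp 2 (A i)

/-- The orthogonal complement of the span of the rows of `A` with index in `S`. -/
def rowsOrtho {k d : ℕ} (A : Matrix (Fin k) (Fin d) ℝ) (S : Set (Fin k)) :
    Submodule ℝ (EuclideanSpace ℝ (Fin d)) :=
  (Submodule.span ℝ (row A '' S))ᗮ

/-- A matrix whose columns are an orthonormal basis of the orthogonal complement of the span of
the rows of `A` with index in `S`. -/
def orthoBasis {k d : ℕ} (A : Matrix (Fin k) (Fin d) ℝ) (S : Set (Fin k)) :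
    Matrix (Fin d) (Fin (Module.finrank ℝ (rowsOrtho A S))) ℝ :=
  Matrix.of fun i j =>
    (stdOrthonormalBasis ℝ (rowsOrtho A S) j : EuclideanSpace ℝ (Fin d)) i

/-! ### The constrained aCSS procedure (parameter space `ℝᵈ`) -/

/-- The data used by the procedure: densities `f θ x` with respect to a base measure, the
regularizer `R`, the constraints `A θ ≤ b`, and the noise level `σ`. -/
structure Problem (𝓧 : Type*) [MeasurableSpace 𝓧] (d k : ℕ) where
  /-- base measure on the sample space -/
  base : Measure 𝓧
  /-- density of the model at parameter `θ` -/
  f : EuclideanSpace ℝ (Fin d) → 𝓧 → ℝ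
  /-- regularizer -/
  R : EuclideanSpace ℝ (Fin d) → ℝ
  /-- constraint matrix -/
  A : Matrix (Fin k) (Fin d) ℝ
  /-- constraint vector -/
  b : Fin k → ℝ
  /-- noise level -/
  σ : ℝ

namespace Problem

variable {𝓧 : Type*} [MeasurableSpace 𝓧] {d k : ℕ}

/-- Regularized negative log-likelihood. -/
def loss₀ (p : Problem 𝓧 d k) (θ : EuclideanSpace ℝ (Fin d)) (x : 𝓧) : ℝ :=
  -Real.log (p.f θ x) + p.R θ

/-- Regularized negative log-likelihood with the random linear perturbation. -/
def loss (p : Problem 𝓧 d k) (θ : EuclideanSpace ℝ (Fin d)) (x : 𝓧)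
    (w : EuclideanSpace ℝ (Fin d)) : ℝ :=
  p.loss₀ θ x + p.σ * inner ℝ w θ

/-- The feasible set `{θ : A θ ≤ b}`. -/
def feasible (p : Problem 𝓧 d k) : Set (EuclideanSpace ℝ (Fin d)) :=
  {θ | ∀ i, (p.A *ᵥ θ.ofLp) i ≤ p.b i}

/-- The active constraints at `θ`. -/
def activeSet (p : Problem 𝓧 d k) (θ : EuclideanSpace ℝ (Fin d)) : Set (Fin k) :=
  {i | (p.A *ᵥ θ.ofLp) i = p.b i}

/-- `θ` minimizes the perturbed loss over the feasible set. -/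
def IsConstrainedMin (p : Problem 𝓧 d k) (x : 𝓧) (w θ : EuclideanSpace ℝ (Fin d)) : Prop :=
  θ ∈ p.feasible ∧ IsMinOn (fun t => p.loss t x w) p.feasible θ

/-- The constrained perturbed maximum likelihood estimator
`argmin {L(θ; x, w) : A θ ≤ b}` (an arbitrary value if there is no minimizer). -/
def thetaHat (p : Problem 𝓧 d k) (x : 𝓧) (w : EuclideanSpace ℝ (Fin d)) :
    EuclideanSpace ℝ (Fin d) :=
  Classical.epsilon fun θ => p.IsConstrainedMin x w θ

/-- The gradient of the perturbed loss at the estimator. -/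
def gHat (p : Problem 𝓧 d k) (x : 𝓧) (w : EuclideanSpace ℝ (Fin d)) :
    EuclideanSpace ℝ (Fin d) :=
  gradient (fun t => p.loss t x w) (p.thetaHat x w)

/-- Strict second-order stationary point of the constrained problem: feasibility, the KKT
conditions, and positive definiteness of the Hessian orthogonally to the active constraints. -/
structure IsSSOSP (p : Problem 𝓧 d k) (x : 𝓧) (w θ : EuclideanSpace ℝ (Fin d)) : Prop where
  feasible : θ ∈ p.feasible
  kkt : ∃ lam : Fin k → ℝ, (∀ i, 0 ≤ lam i) ∧ (∀ i, i ∉ p.activeSet θ → lam i = 0) ∧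
    gradient (fun t => p.loss t x w) θ + ∑ i, lam i • row p.A i = 0
  second_order : ((orthoBasis p.A (p.activeSet θ))ᵀ * hessian (fun t => p.loss t x w) θ *
    orthoBasis p.A (p.activeSet θ)).PosDef

/-- The set of data values `x` compatible with `(θ, g)`. -/
def compatible (p : Problem 𝓧 d k) (θ g : EuclideanSpace ℝ (Fin d)) : Set 𝓧 :=
  {x | ∃ w, θ = p.thetaHat x w ∧ p.IsSSOSP x w θ ∧ g = gradient (fun t => p.loss t x w) θ}

/-- The unnormalized plug-in conditional density of the data given `(θ, g)`. -/
def plugInDensity (p : Problem 𝓧 d k) (θ g : EuclideanSpace ℝ (Fin d)) : 𝓧 → ℝ :=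
  (p.compatible θ g).indicator fun x =>
    p.f θ x *
      Real.exp (-(‖g - gradient (fun t => p.loss₀ t x) θ‖ ^ 2 / (2 * p.σ ^ 2 / (d : ℝ)))) *
      ((orthoBasis p.A (p.activeSet θ))ᵀ * hessian (fun t => p.loss₀ t x) θ *
        orthoBasis p.A (p.activeSet θ)).det

/-- The plug-in conditional law of the data given `(θ, g)`: the normalization of the previous
density. -/
def plugInLaw (p : Problem 𝓧 d k) (θ g : EuclideanSpace ℝ (Fin d)) : Measure 𝓧 :=
  (∫⁻ x, ENNReal.ofReal (p.plugInDensity θ g x) ∂p.base)⁻¹ •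
    p.base.withDensity fun x => ENNReal.ofReal (p.plugInDensity θ g x)

/-- The joint law of `(X, X̃⁽¹⁾, …, X̃⁽ᴹ⁾)` when `X` is drawn from the plug-in law at `(θ, g)` and
then the copies are drawn from `κ (X, θ, g)`. -/
def plugInJointLaw (p : Problem 𝓧 d k) {M : ℕ}
    (κ : Kernel (𝓧 × EuclideanSpace ℝ (Fin d) × EuclideanSpace ℝ (Fin d)) (Fin M → 𝓧))
    (θ g : EuclideanSpace ℝ (Fin d)) : Measure (Fin (M + 1) → 𝓧) :=
  ((p.plugInLaw θ g) ⊗ₘ (κ.comap (fun x => (x, θ, g)) (by fun_prop))).map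
    fun y => Fin.cons y.1 y.2

/-- The requirement on the sampling mechanism of the copies: for all `(θ, g)` at which the
plug-in law is a well defined probability distribution, if `X` has this law and the copies
are drawn from `κ (X, θ, g)`, then `X` and the copies are exchangeable. -/
def IsExchangeableSampler (p : Problem 𝓧 d k) {M : ℕ}
    (κ : Kernel (𝓧 × EuclideanSpace ℝ (Fin d) × EuclideanSpace ℝ (Fin d)) (Fin M → 𝓧)) :
    Prop :=
  ∀ θ g, IsProbabilityMeasure (p.plugInLaw θ g) → IsExchangeable (p.plugInJointLaw κ θ g)

open Classical in
/-- The conditional law of the copies given `X = x` and `W = w`: the copies are drawn from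
`κ (x, θ̂, ĝ)` if the estimator is a strict second-order stationary point, and are all equal to
`x` otherwise. -/
def copiesLaw (p : Problem 𝓧 d k) {M : ℕ}
    (κ : Kernel (𝓧 × EuclideanSpace ℝ (Fin d) × EuclideanSpace ℝ (Fin d)) (Fin M → 𝓧))
    (x : 𝓧) (w : EuclideanSpace ℝ (Fin d)) : Measure (Fin M → 𝓧) :=
  if p.IsSSOSP x w (p.thetaHat x w) then κ (x, p.thetaHat x w, p.gHat x w)
  else Measure.dirac fun _ => x

/-- `(X, W, X̃⁽¹⁾, …, X̃⁽ᴹ⁾)`, defined on the probability space `(Ω, P)`, are generated by the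
constrained aCSS procedure with data law `PX` and sampling mechanism `κ`. -/
structure IsRun (p : Problem 𝓧 d k) {M : ℕ}
    (κ : Kernel (𝓧 × EuclideanSpace ℝ (Fin d) × EuclideanSpace ℝ (Fin d)) (Fin M → 𝓧))
    (PX : Measure 𝓧) {Ω : Type*} [MeasurableSpace Ω] (P : Measure Ω)
    (X : Ω → 𝓧) (W : Ω → EuclideanSpace ℝ (Fin d)) (Xt : Fin M → Ω → 𝓧) : Prop where
  /-- `X ∼ PX` and `W ∼ N(0, I/d)` are independent. -/
  law_data : HasLaw (fun ω => (X ω, W ω))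
    (PX.prod (multivariateGaussian 0 ((1 / (d : ℝ)) • (1 : Matrix (Fin d) (Fin d) ℝ)))) P
  aemeasurable_copies : ∀ m, AEMeasurable (Xt m) P
  /-- the conditional law of the copies given `(X, W)` -/
  law_copies : ∀ (S : Set (𝓧 × EuclideanSpace ℝ (Fin d))) (B : Set (Fin M → 𝓧)),
    MeasurableSet S → MeasurableSet B →
    P {ω | (X ω, W ω) ∈ S ∧ (fun m => Xt m ω) ∈ B} =
      ∫⁻ ω in {ω | (X ω, W ω) ∈ S}, p.copiesLaw κ (X ω) (W ω) B ∂P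

end Problem

/-! ### The Gaussian linear model -/

/-- The vector `Z θ`. -/
def linMean {n d : ℕ} (Z : Matrix (Fin n) (Fin d) ℝ) (θ : EuclideanSpace ℝ (Fin d)) :
    EuclideanSpace ℝ (Fin n) :=
  WithLp.toLp 2 (Z *ᵥ θ.ofLp)

/-- The law `N(Zθ, ν² Iₙ)`. -/
def gaussianLaw {n d : ℕ} (Z : Matrix (Fin n) (Fin d) ℝ) (ν : ℝ)
    (θ : EuclideanSpace ℝ (Fin d)) : Measure (EuclideanSpace ℝ (Fin n)) :=
  multivariateGaussian (linMean Z θ) (ν ^ 2 • (1 : Matrix (Fin n) (Fin n) ℝ))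

/-- The Lebesgue density of `N(Zθ, ν² Iₙ)`. -/
def gaussianDensity {n d : ℕ} (Z : Matrix (Fin n) (Fin d) ℝ) (ν : ℝ)
    (θ : EuclideanSpace ℝ (Fin d)) (x : EuclideanSpace ℝ (Fin n)) : ℝ :=
  1 / (2 * Real.pi * ν ^ 2) ^ ((n : ℝ) / 2) * Real.exp (-(‖x - linMean Z θ‖ ^ 2 / (2 * ν ^ 2)))

/-- The data of the constrained aCSS procedure in the Gaussian linear model. -/
def gaussianProblem {n d k : ℕ} (Z : Matrix (Fin n) (Fin d) ℝ) (ν : ℝ)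
    (R : EuclideanSpace ℝ (Fin d) → ℝ) (A : Matrix (Fin k) (Fin d) ℝ) (b : Fin k → ℝ) (σ : ℝ) :
    Problem (EuclideanSpace ℝ (Fin n)) d k where
  base := volume
  f := gaussianDensity Z ν
  R := R
  A := A
  b := b
  σ := σ

end ACSS

end

noncomputable section

namespace ACSS

/-! Up to a term free of `θ`, the loss depends on `(x, w)` only through the perturbed score `u = σ w
- ν⁻² Zᵀ x`. Hence the estimator and the gradient there are functions of `u`, and `u` is recovered
from them by subtracting `potentialGrad`. Strong convexity makes every constrained minimizer an
SSOSP, so the fallback branch of the procedure never occurs, and it makes the estimator a Lipschitz,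
hence measurable, function of `u`.

Given `u`, the data under `θ₀` are Gaussian with precision form `q = precision`, which depends on
neither `θ₀` nor `u`, and with mean `condMean θ₀ u` (`complete_square`, `lintegral_score`). The
plug-in law is this same Gaussian with the mean taken at the estimator (`plugInLaw_eq`): every `x`
is compatible with the pair coming from `u`, and the Hessian determinant is constant in `x`, so both
drop out on normalization.

The comparison law keeps the marginal law of `u` but draws the data from the plug-in law given `u`,
then the copies from the sampler. It is a mixture of exchangeable laws, hence exchangeable. It
differs from the true law only through the shift of the conditional mean. Translating the Gaussian
by `η` costs at most `√(q η) / 2` in total variation (`lintegral_add_right_expLaw_le`), and for two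
parameters `q` of the difference of means is at most `(σ² / d) ‖θ - θ'‖²`
(`precision_condMean_sub_le`). On the event that the estimator is within `r` of `θ₀` this gives `σ r
/ (2 √d)`; the complement costs at most `δ`. The p-value bound follows because rank p-values are
superuniform under the exchangeable law. -/

lemma half_abs_sub_le {a b ε : ℝ} (hε : 0 < ε) :
    |Real.exp (-a) - Real.exp (-b)| ≤
      1 / 2 * ((ε + ε⁻¹) * (Real.exp (-a) + Real.exp (-b))
        + (2 * ε⁻¹ - 2 * ε) * Real.exp (-((a + b) / 2))) := by
  set x := Real.exp (-(a / 2)) with hx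
  set y := Real.exp (-(b / 2)) with hy
  have ha : Real.exp (-a) = x ^ 2 := by rw [hx, ← Real.exp_nat_mul]; congr 1; push_cast; ring
  have hb : Real.exp (-b) = y ^ 2 := by rw [hy, ← Real.exp_nat_mul]; congr 1; push_cast; ring
  have hab : Real.exp (-((a + b) / 2)) = x * y := by rw [hx, hy, ← Real.exp_add]; congr 1; ring
  have hx0 : 0 < x := Real.exp_pos _
  have hy0 : 0 < y := Real.exp_pos _
  rw [ha, hb, hab, show x ^ 2 - y ^ 2 = (x - y) * (x + y) by ring, abs_mul,
    abs_of_pos (by positivity : 0 < x + y)]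
  -- Weighted AM-GM for the product `|x - y| (x + y)`. Keeping `ε` free replaces the Cauchy–Schwarz
  -- step in the Hellinger bound on total variation: `ε` is optimized only after integration.
  have key : 0 ≤ ε⁻¹ * (ε * |x - y| - (x + y)) ^ 2 := by positivity
  have h1 : ε⁻¹ * (ε * |x - y| - (x + y)) ^ 2 =
      ε * (x - y) ^ 2 - 2 * (|x - y| * (x + y)) + ε⁻¹ * (x + y) ^ 2 := by
    rw [← sq_abs (x - y)]
    field_simp
    ring
  nlinarith [h1, key]

lemma eval_half_of_parallelogram {V : Type*} [AddCommGroup V] [Module ℝ V] {q : V → ℝ}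
    (hpar : ∀ x y, q (x + y) + q (x - y) = 2 * q x + 2 * q y) (η : V) :
    q ((1 / 2 : ℝ) • η) = q η / 4 := by
  have h0 : q 0 = 0 := by have := hpar 0 0; simp at this; linarith
  have := hpar ((1 / 2 : ℝ) • η) ((1 / 2 : ℝ) • η)
  rw [← add_smul, sub_self, h0] at this
  norm_num at this ⊢
  linarith

/-! ### Total variation between translates of a Gaussian-type law -/

section ShiftTV

variable {V : Type*} [NormedAddCommGroup V] [InnerProductSpace ℝ V] [FiniteDimensional ℝ V]
  [MeasurableSpace V] [BorelSpace V]

/-- The probability measure with Lebesgue density proportional to `exp (-q / 2)`. -/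
def expLaw (q : V → ℝ) : Measure V :=
  volume.withDensity fun z =>
    ENNReal.ofReal ((∫ y, Real.exp (-(q y / 2)))⁻¹ * Real.exp (-(q z / 2)))

lemma isProbabilityMeasure_expLaw {q : V → ℝ}
    (hint : Integrable fun z => Real.exp (-(q z / 2))) : IsProbabilityMeasure (expLaw q) := by
  refine ⟨?_⟩
  have h0 := integral_exp_pos hint
  rw [expLaw, withDensity_apply _ MeasurableSet.univ, setLIntegral_univ,
    ← ofReal_integral_eq_lintegral_ofReal (hint.const_mul _)
      (Filter.Eventually.of_forall fun z => by positivity), integral_const_mul,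
    inv_mul_cancel₀ h0.ne', ENNReal.ofReal_one]

/-- Hellinger's bound: the affinity of the law and its translate is `B = exp (-q η / 8)`, the L¹
distance of the normalized densities is at most `2 √(1 - B²)`, and `1 - B² = 1 - exp (-q η / 4) ≤ q
η / 4`. The parallelogram law is all that is needed of the quadratic form. -/
lemma integral_abs_exp_sub_le {q : V → ℝ}
    (hpar : ∀ x y, q (x + y) + q (x - y) = 2 * q x + 2 * q y) (hq : ∀ x, 0 ≤ q x)
    (hint : Integrable fun z => Real.exp (-(q z / 2))) (η : V) :
    ∫ z, |Real.exp (-(q (z - η) / 2)) - Real.exp (-(q z / 2))| ≤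
      √(q η) * ∫ z, Real.exp (-(q z / 2)) := by
  set N := ∫ z, Real.exp (-(q z / 2)) with hN
  have hN0 : 0 < N := integral_exp_pos hint
  have hint' : ∀ ξ : V, Integrable fun z => Real.exp (-(q (z - ξ) / 2)) :=
    fun ξ => hint.comp_sub_right ξ
  have hI : ∀ ξ : V, ∫ z, Real.exp (-(q (z - ξ) / 2)) = N :=
    fun ξ => integral_sub_right_eq_self (fun z => Real.exp (-(q z / 2))) ξ
  set B := Real.exp (-(q η / 8)) with hB
  -- The geometric mean of the two translates is `B` times the translate by `η / 2`, by the
  -- parallelogram law around the midpoint; its integral is therefore `B * N`.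
  have hmid : ∀ z, Real.exp (-((q (z - η) / 2 + q z / 2) / 2)) =
      B * Real.exp (-(q (z - (1 / 2 : ℝ) • η) / 2)) := by
    intro z
    have h1 := hpar (z - (1 / 2 : ℝ) • η) ((1 / 2 : ℝ) • η)
    rw [eval_half_of_parallelogram hpar, sub_add_cancel, sub_sub, ← add_smul] at h1
    norm_num at h1
    rw [hB, ← Real.exp_add]
    congr 1
    norm_num
    linarith
  have bound : ∀ ε : ℝ, 0 < ε →
      ∫ z, |Real.exp (-(q (z - η) / 2)) - Real.exp (-(q z / 2))| ≤
        N * (ε * (1 - B) + ε⁻¹ * (1 + B)) := by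
    intro ε hε
    calc _ ≤ ∫ z, 1 / 2 * ((ε + ε⁻¹) * (Real.exp (-(q (z - η) / 2)) + Real.exp (-(q z / 2)))
        + (2 * ε⁻¹ - 2 * ε) * (B * Real.exp (-(q (z - (1 / 2 : ℝ) • η) / 2)))) := by
          refine integral_mono (((hint' η).sub hint).abs)
            (((((hint' η).add hint).const_mul _).add
              (((hint' _).const_mul _).const_mul _)).const_mul _) fun z => ?_
          have := half_abs_sub_le (a := q (z - η) / 2) (b := q z / 2) hε
          rw [hmid] at this
          exact this
      _ = _ := by
          rw [integral_const_mul, integral_add, integral_const_mul, integral_add (hint' η) hint,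
            integral_const_mul, integral_const_mul, hI, hI, ← hN]
          · ring
          · exact ((hint' η).add hint).const_mul _
          · exact ((hint' _).const_mul _).const_mul _
  have hB0 : 0 < B := Real.exp_pos _
  rcases (hq η).eq_or_lt with h0 | h0
  -- Degenerate direction: the bound is `2 N / ε`, which is made arbitrarily small by large `ε`.
  · have hB1 : B = 1 := by rw [hB, ← h0]; simp
    rw [← h0, Real.sqrt_zero, zero_mul]
    refine le_of_forall_pos_le_add fun e he => ?_
    refine (bound (2 * N / e) (by positivity)).trans (le_of_eq ?_)
    rw [hB1]; field_simp; ring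
  · have hs : 0 < √(q η) := Real.sqrt_pos.2 h0
    have hss : √(q η) ^ 2 = q η := Real.sq_sqrt h0.le
    have hB1 : B < 1 := by rw [hB, Real.exp_lt_one_iff]; linarith
    have hBB : 1 - B ^ 2 ≤ q η / 4 := by
      have : B ^ 2 = Real.exp (-(q η / 4)) := by
        rw [hB, ← Real.exp_nat_mul]; congr 1; push_cast; ring
      have h2 := Real.add_one_le_exp (-(q η / 4))
      linarith
    -- This weight makes the first term exactly `√(q η) / 2`; the estimate of `1 - B²` bounds the
    -- second by the same amount.
    set ε := √(q η) / (2 * (1 - B)) with hε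
    have h1B : 0 < 1 - B := by linarith
    have hε0 : 0 < ε := by positivity
    refine (bound ε hε0).trans ?_
    rw [mul_comm]
    refine mul_le_mul_of_nonneg_right ?_ hN0.le
    have h1 : ε * (1 - B) = √(q η) / 2 := by rw [hε]; field_simp
    have h2 : ε⁻¹ * (1 + B) = 2 * (1 - B ^ 2) / √(q η) := by rw [hε]; field_simp; ring
    have h3 : 2 * (1 - B ^ 2) / √(q η) ≤ √(q η) / 2 := by
      rw [div_le_iff₀ hs]; nlinarith
    linarith

/-- Total variation between a centred Gaussian-type law and its translate. -/
lemma lintegral_add_right_expLaw_le {q : V → ℝ} (hqm : Measurable q)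
    (hpar : ∀ x y, q (x + y) + q (x - y) = 2 * q x + 2 * q y) (hq : ∀ x, 0 ≤ q x)
    (hint : Integrable fun z => Real.exp (-(q z / 2))) (η : V)
    {h : V → ℝ≥0∞} (hh : Measurable h) (h1 : ∀ z, h z ≤ 1) :
    ∫⁻ z, h (z + η) ∂(expLaw q) ≤ ∫⁻ z, h z ∂(expLaw q) + ENNReal.ofReal (√(q η) / 2) := by
  set N := ∫ z, Real.exp (-(q z / 2)) with hN
  have hN0 : 0 < N := integral_exp_pos hint
  set p : V → ℝ := fun z => N⁻¹ * Real.exp (-(q z / 2)) with hp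
  have hp0 : ∀ z, 0 ≤ p z := fun z => by positivity
  have hpm : Measurable p := by fun_prop
  have hpi : Integrable p := hint.const_mul _
  have hpi' : Integrable fun z => p (z - η) := hpi.comp_sub_right η
  have hlaw : ∀ f : V → ℝ≥0∞, Measurable f →
      ∫⁻ z, f z ∂(expLaw q) = ∫⁻ z, ENNReal.ofReal (p z) * f z := by
    intro f hf
    rw [expLaw, lintegral_withDensity_eq_lintegral_mul _ (by fun_prop) hf]
    rfl
  rw [hlaw _ hh, hlaw _ (by fun_prop)]
  have hshift : ∫⁻ z, ENNReal.ofReal (p z) * h (z + η) =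
      ∫⁻ z, ENNReal.ofReal (p (z - η)) * h z := by
    rw [← lintegral_add_right_eq_self (fun z => ENNReal.ofReal (p (z - η)) * h z) η]
    simp
  rw [hshift]
  have hpos : ∫⁻ z, ENNReal.ofReal (max (p (z - η) - p z) 0) ≤ ENNReal.ofReal (√(q η) / 2) := by
    have hi : Integrable fun z => max (p (z - η) - p z) 0 := (hpi'.sub hpi).pos_part
    rw [← ofReal_integral_eq_lintegral_ofReal hi
      (Filter.Eventually.of_forall fun z => le_max_right _ _)]
    refine ENNReal.ofReal_le_ofReal ?_
    -- The positive part is half the absolute value plus half the difference, and the difference of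
    -- two densities integrates to zero. This is the source of the factor `1 / 2`.
    have e1 : ∀ z, max (p (z - η) - p z) 0 =
        1 / 2 * (N⁻¹ * |Real.exp (-(q (z - η) / 2)) - Real.exp (-(q z / 2))|)
          + 1 / 2 * (p (z - η) - p z) := by
      intro z
      have e2 : N⁻¹ * |Real.exp (-(q (z - η) / 2)) - Real.exp (-(q z / 2))| =
          |p (z - η) - p z| := by
        simp only [hp]
        rw [← mul_sub, abs_mul, abs_of_pos (inv_pos.2 hN0)]
      rw [e2]
      rcases le_total (p (z - η) - p z) 0 with h | h
      · rw [max_eq_right h, abs_of_nonpos h]; ring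
      · rw [max_eq_left h, abs_of_nonneg h]; ring
    have hia : Integrable fun z => |Real.exp (-(q (z - η) / 2)) - Real.exp (-(q z / 2))| :=
      ((hint.comp_sub_right η).sub hint).abs
    have hpp : Integrable fun z => p (z - η) - p z := hpi'.sub hpi
    simp_rw [e1]
    rw [integral_add ((hia.const_mul _).const_mul _) (hpp.const_mul _),
      integral_const_mul, integral_const_mul, integral_const_mul, integral_sub hpi' hpi,
      integral_sub_right_eq_self p η, sub_self, mul_zero, add_zero]
    have := integral_abs_exp_sub_le hpar hq hint η
    rw [← hN] at this
    calc _ ≤ 1 / 2 * (N⁻¹ * (√(q η) * N)) := by gcongr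
      _ = _ := by field_simp
  calc _ ≤ ∫⁻ z, (ENNReal.ofReal (p z) * h z + ENNReal.ofReal (max (p (z - η) - p z) 0)) := by
        refine lintegral_mono fun z => ?_
        have : ENNReal.ofReal (p (z - η)) ≤
            ENNReal.ofReal (p z) + ENNReal.ofReal (max (p (z - η) - p z) 0) := by
          rw [← ENNReal.ofReal_add (hp0 _) (le_max_right _ _)]
          exact ENNReal.ofReal_le_ofReal (by linarith [le_max_left (p (z - η) - p z) 0])
        calc _ ≤ (ENNReal.ofReal (p z) + ENNReal.ofReal (max (p (z - η) - p z) 0)) * h z := by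
              gcongr
          _ ≤ _ := by
              rw [add_mul]
              gcongr
              exact mul_le_of_le_one_right' (h1 z)
    _ ≤ _ := by
        rw [lintegral_add_left (by fun_prop)]
        gcongr

end ShiftTV

/-! ### Conditional mean and precision of the data given the perturbed score -/

section Quadratic

variable {E V : Type*} [NormedAddCommGroup E] [InnerProductSpace ℝ E] [FiniteDimensional ℝ E]
  [NormedAddCommGroup V] [InnerProductSpace ℝ V] [FiniteDimensional ℝ V]

/-- The scaled adjoint `ν⁻² L†`. -/
def scaledAdjoint (L : E →L[ℝ] V) (ν : ℝ) : V →L[ℝ] E := (1 / ν ^ 2) • L.adjoint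

lemma inner_scaledAdjoint (L : E →L[ℝ] V) (ν : ℝ) (z : V) (a : E) :
    inner ℝ (scaledAdjoint L ν z) a = 1 / ν ^ 2 * inner ℝ z (L a) := by
  simp [scaledAdjoint, real_inner_smul_left, ContinuousLinearMap.adjoint_inner_left]

/-- The quadratic form of the inverse conditional covariance. -/
def precision (L : E →L[ℝ] V) (ν s : ℝ) (z : V) : ℝ :=
  ‖z‖ ^ 2 / ν ^ 2 + ‖scaledAdjoint L ν z‖ ^ 2 / s

variable (L : E →L[ℝ] V) {ν s : ℝ}

lemma precision_nonneg (hs : 0 < s) (z : V) : 0 ≤ precision L ν s z := by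
  unfold precision; positivity

lemma continuous_precision : Continuous (precision L ν s) := by
  unfold precision; fun_prop

lemma precision_parallelogram (x y : V) :
    precision L ν s (x + y) + precision L ν s (x - y) =
      2 * precision L ν s x + 2 * precision L ν s y := by
  have h1 := parallelogram_law_with_norm ℝ x y
  have h2 := parallelogram_law_with_norm ℝ (scaledAdjoint L ν x) (scaledAdjoint L ν y)
  simp only [precision, map_add, map_sub]
  calc _ = (‖x + y‖ ^ 2 + ‖x - y‖ ^ 2) / ν ^ 2
      + (‖scaledAdjoint L ν x + scaledAdjoint L ν y‖ ^ 2
        + ‖scaledAdjoint L ν x - scaledAdjoint L ν y‖ ^ 2) / s := by ring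
    _ = _ := by rw [h1, h2]; ring

lemma integrable_exp_precision [MeasurableSpace V] [BorelSpace V] (hν : 0 < ν) (hs : 0 < s) :
    Integrable fun z : V => Real.exp (-(precision L ν s z / 2)) := by
  have h := GaussianFourier.integrable_cexp_neg_mul_sq_norm_add (V := V)
    (b := ((1 / (2 * ν ^ 2) : ℝ) : ℂ)) (by rw [Complex.ofReal_re]; positivity) 0 0
  refine h.norm.mono' ?_ (Filter.Eventually.of_forall fun z => ?_)
  · have := continuous_precision L (ν := ν) (s := s)
    exact Continuous.aestronglyMeasurable (by fun_prop)
  · rw [Complex.norm_exp, Real.norm_eq_abs, abs_of_pos (Real.exp_pos _)]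
    refine Real.exp_le_exp.2 ?_
    have e : (-((1 / (2 * ν ^ 2) : ℝ) : ℂ) * (‖z‖ : ℂ) ^ 2 + 0 * ((inner ℝ (0 : V) z : ℝ) : ℂ)).re
        = -(‖z‖ ^ 2 / (2 * ν ^ 2)) := by
      rw [show (-((1 / (2 * ν ^ 2) : ℝ) : ℂ) * (‖z‖ : ℂ) ^ 2 + 0 * ((inner ℝ (0 : V) z : ℝ) : ℂ)) =
        ((-(‖z‖ ^ 2 / (2 * ν ^ 2)) : ℝ) : ℂ) by push_cast; ring, Complex.ofReal_re]
    rw [e]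
    have h1 : 0 ≤ ‖scaledAdjoint L ν z‖ ^ 2 / s := by positivity
    have h2 : ‖z‖ ^ 2 / (2 * ν ^ 2) = ‖z‖ ^ 2 / ν ^ 2 / 2 := by field_simp
    unfold precision
    linarith

/-- The covariance operator `ν⁻² L† L + s` of the perturbed score. -/
def scoreCov (ν s : ℝ) : E →ₗ[ℝ] E :=
  (scaledAdjoint L ν ∘L L : E →L[ℝ] E).toLinearMap + s • LinearMap.id

lemma scoreCov_apply (a : E) : scoreCov L ν s a = scaledAdjoint L ν (L a) + s • a := by
  simp [scoreCov]

lemma inner_scoreCov_self (a : E) :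
    inner ℝ (scoreCov L ν s a) a = ‖L a‖ ^ 2 / ν ^ 2 + s * ‖a‖ ^ 2 := by
  rw [scoreCov_apply, inner_add_left, inner_scaledAdjoint, real_inner_smul_left,
    real_inner_self_eq_norm_sq, real_inner_self_eq_norm_sq]
  ring

lemma scoreCov_injective (hs : 0 < s) : Function.Injective (scoreCov L ν s) := by
  rw [injective_iff_map_eq_zero]
  intro a ha
  have h := inner_scoreCov_self L (ν := ν) (s := s) a
  rw [ha, inner_zero_left] at h
  have h1 : 0 ≤ ‖L a‖ ^ 2 / ν ^ 2 := by positivity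
  have h2 : ‖a‖ ^ 2 = 0 := by nlinarith [sq_nonneg ‖a‖]
  simpa using h2

/-- A linear right inverse of `scoreCov`. -/
def scoreCovInv (ν s : ℝ) : E →ₗ[ℝ] E := by
  classical exact
  if h : Function.Injective (scoreCov L ν s) then
    (LinearEquiv.ofInjectiveEndo (scoreCov L ν s) h).symm.toLinearMap else 0

lemma scoreCov_scoreCovInv (hs : 0 < s) (v : E) :
    scoreCov L ν s (scoreCovInv L ν s v) = v := by
  have h := scoreCov_injective L (ν := ν) hs
  rw [scoreCovInv, dif_pos h]
  exact LinearEquiv.apply_symm_apply (LinearEquiv.ofInjectiveEndo (scoreCov L ν s) h) v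

/-- The conditional mean of the data given the perturbed score `u`, at the parameter `θ`. -/
def condMean (ν s : ℝ) (θ u : E) : V :=
  L (θ - scoreCovInv L ν s (u + scaledAdjoint L ν (L θ)))

lemma continuous_condMean : Continuous fun y : E × E => condMean L ν s y.1 y.2 := by
  have : Continuous (scoreCovInv L ν s) := LinearMap.continuous_of_finiteDimensional _
  unfold condMean
  fun_prop

/-- Completing the square in the joint density of the data and the perturbed score. -/
lemma complete_square (hs : 0 < s) (θ u : E) (x : V) :
    ‖x - L θ‖ ^ 2 / ν ^ 2 + ‖u + scaledAdjoint L ν x‖ ^ 2 / s =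
      precision L ν s (x - condMean L ν s θ u) +
        inner ℝ (u + scaledAdjoint L ν (L θ))
          (scoreCovInv L ν s (u + scaledAdjoint L ν (L θ))) := by
  set v := u + scaledAdjoint L ν (L θ) with hv
  -- At the minimizer in `x` the residual `u + ν⁻² L† x` equals `s • a`, so the inverse is taken in
  -- parameter space only. After recentring at `z`, the cross terms `∓ 2 ν⁻² ⟪z, L a⟫` of the two
  -- squares cancel.
  set a := scoreCovInv L ν s v with ha
  have hTa : scoreCov L ν s a = v := scoreCov_scoreCovInv L hs v
  set z := x - condMean L ν s θ u with hz
  have hx : x = z + L θ - L a := by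
    rw [hz, condMean, ← hv, ← ha, map_sub]; abel
  have h1 : x - L θ = z - L a := by rw [hx]; abel
  have h2 : u + scaledAdjoint L ν x = scaledAdjoint L ν z + s • a := by
    have : u = v - scaledAdjoint L ν (L θ) := by rw [hv]; abel
    rw [hx, this, ← hTa, scoreCov_apply, map_sub, map_add]; abel
  have h3 := inner_scoreCov_self L (ν := ν) (s := s) a
  rw [hTa] at h3
  rw [h1, h2, h3, precision, norm_sub_sq_real, norm_add_sq_real, real_inner_smul_right,
    inner_scaledAdjoint, norm_smul, Real.norm_eq_abs, abs_of_pos hs]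
  field_simp
  ring

/-- The means differ by `L β`, where `scoreCov β = s • δ`. Substituting this equation in both terms
of `precision` leaves exactly `s ‖δ‖² - s ⟪δ, β⟫`, and the inner product is nonnegative because
`scoreCov` is positive. -/
lemma precision_condMean_sub_le (hs : 0 < s) (θ θ' u : E) :
    precision L ν s (condMean L ν s θ u - condMean L ν s θ' u) ≤ s * ‖θ - θ'‖ ^ 2 := by
  set δ := θ - θ' with hδ
  set β := δ - scoreCovInv L ν s (scaledAdjoint L ν (L δ)) with hβ
  have e : condMean L ν s θ u - condMean L ν s θ' u = L β := by
    simp only [condMean, ← map_sub, hβ, hδ]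
    congr 1
    rw [sub_sub_sub_comm, ← map_sub]
    congr 2
    simp only [map_sub]
    abel
  have hT : scoreCov L ν s β = s • δ := by
    rw [hβ, map_sub, scoreCov_scoreCovInv L hs, scoreCov_apply]; abel
  have hK : scaledAdjoint L ν (L β) = s • δ - s • β := by
    rw [← hT, scoreCov_apply]; abel
  have h1 := inner_scoreCov_self L (ν := ν) (s := s) β
  rw [hT, real_inner_smul_left] at h1
  have h2 : ‖s • δ - s • β‖ ^ 2 = s ^ 2 * (‖δ‖ ^ 2 - 2 * inner ℝ δ β + ‖β‖ ^ 2) := by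
    rw [← smul_sub, norm_smul, mul_pow, norm_sub_sq_real, Real.norm_eq_abs, sq_abs]
  have h3 : 0 ≤ inner ℝ δ β := by
    have : 0 ≤ s * inner ℝ δ β := by rw [h1]; positivity
    exact nonneg_of_mul_nonneg_right this hs
  have h4 : s ^ 2 * (‖δ‖ ^ 2 - 2 * inner ℝ δ β + ‖β‖ ^ 2) / s =
    s * (‖δ‖ ^ 2 - 2 * inner ℝ δ β + ‖β‖ ^ 2) := by field_simp
  rw [e, precision, hK, h2, h4]
  nlinarith [mul_nonneg hs.le h3]

end Quadratic

/-! ### Isotropic Gaussian densities -/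

section Density

variable {ι : Type*} [Fintype ι]

/-- The Lebesgue density of `N(m, τ I)`. -/
def isoDensity (τ : ℝ) (m x : EuclideanSpace ℝ ι) : ℝ :=
  1 / (2 * Real.pi * τ) ^ ((Fintype.card ι : ℝ) / 2) * Real.exp (-(‖x - m‖ ^ 2 / (2 * τ)))

lemma integrable_isoDensity {τ : ℝ} (hτ : 0 < τ) (m : EuclideanSpace ℝ ι) :
    Integrable (isoDensity τ m) := by
  have h := GaussianFourier.integrable_cexp_neg_mul_sq_norm_add (V := EuclideanSpace ℝ ι)
    (b := ((1 / (2 * τ) : ℝ) : ℂ)) (by rw [Complex.ofReal_re]; positivity) 0 0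
  have h2 := ((h.re.comp_sub_right m).const_mul (1 / (2 * Real.pi * τ) ^ ((Fintype.card ι : ℝ) / 2)))
  refine h2.congr (Filter.Eventually.of_forall fun x => ?_)
  simp only [isoDensity]
  congr 1
  rw [show (-((1 / (2 * τ) : ℝ) : ℂ) * (‖x - m‖ : ℂ) ^ 2
      + 0 * ((inner ℝ (0 : EuclideanSpace ℝ ι) (x - m) : ℝ) : ℂ)) =
    ((-(‖x - m‖ ^ 2 / (2 * τ)) : ℝ) : ℂ) by push_cast; ring, ← Complex.ofReal_exp]
  exact Complex.ofReal_re _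

/-- Both sides have the same characteristic function, by the Gaussian Fourier integral. Equality of
finite measures follows, so the normalizing constant needs no separate check. -/
lemma multivariateGaussian_smul_one_eq_withDensity [DecidableEq ι] {τ : ℝ} (hτ : 0 < τ)
    (m : EuclideanSpace ℝ ι) :
    multivariateGaussian m (τ • (1 : Matrix ι ι ℝ)) =
      volume.withDensity fun x => ENNReal.ofReal (isoDensity τ m x) := by
  have hfin := isFiniteMeasure_withDensity_ofReal (integrable_isoDensity hτ m).2
  have hmeas : Measurable (isoDensity τ m) := by unfold isoDensity; fun_prop
  have hnn : ∀ x, 0 ≤ isoDensity τ m x := fun x => by unfold isoDensity; positivity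
  refine Measure.ext_of_charFun ?_
  ext t
  rw [charFun_multivariateGaussian (Matrix.PosSemidef.one.smul hτ.le), charFun_apply,
    integral_withDensity_eq_integral_toReal_smul hmeas.ennreal_ofReal
      (Filter.Eventually.of_forall fun _ => ENNReal.ofReal_lt_top)]
  have hb : 0 < ((1 / (2 * τ) : ℝ) : ℂ).re := by rw [Complex.ofReal_re]; positivity
  have key := GaussianFourier.integral_cexp_neg_mul_sq_norm_add hb Complex.I t
  rw [← integral_add_right_eq_self _ m]
  set C : ℝ := 1 / (2 * Real.pi * τ) ^ ((Fintype.card ι : ℝ) / 2) with hC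
  have e : ∀ x, (ENNReal.ofReal (isoDensity τ m (x + m))).toReal •
      Complex.exp ((inner ℝ (x + m) t : ℝ) * Complex.I) =
      ((C : ℂ) * Complex.exp ((inner ℝ t m : ℝ) * Complex.I)) *
      Complex.exp (-((1 / (2 * τ) : ℝ) : ℂ) * (‖x‖ : ℂ) ^ 2 + Complex.I * (inner ℝ t x : ℝ)) := by
    intro x
    rw [ENNReal.toReal_ofReal (hnn _), isoDensity, add_sub_cancel_right, ← hC, Complex.real_smul,
      inner_add_left, real_inner_comm t x, real_inner_comm t m]
    push_cast
    rw [mul_assoc, mul_assoc, ← Complex.exp_add, ← Complex.exp_add]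
    congr 2
    field_simp
    ring
  simp_rw [e]
  rw [integral_const_mul, key]
  have hpi : ((Real.pi : ℂ) / ((1 / (2 * τ) : ℝ) : ℂ)) = ((2 * Real.pi * τ : ℝ) : ℂ) := by
    have : (τ : ℂ) ≠ 0 := by exact_mod_cast hτ.ne'
    push_cast; field_simp
  have hpow : ((2 * Real.pi * τ : ℝ) : ℂ) ^
      ((Module.finrank ℝ (EuclideanSpace ℝ ι) : ℂ) / 2) =
      (((2 * Real.pi * τ) ^ ((Fintype.card ι : ℝ) / 2) : ℝ) : ℂ) := by
    rw [Complex.ofReal_cpow (by positivity)]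
    simp
  have hne : (2 * Real.pi * τ) ^ ((Fintype.card ι : ℝ) / 2) ≠ 0 := by positivity
  rw [hpi, hpow, show ((C : ℂ) * Complex.exp ((inner ℝ t m : ℝ) * Complex.I)) *
      ((((2 * Real.pi * τ) ^ ((Fintype.card ι : ℝ) / 2) : ℝ) : ℂ) *
        Complex.exp (Complex.I ^ 2 * (‖t‖ : ℂ) ^ 2 / (4 * ((1 / (2 * τ) : ℝ) : ℂ)))) =
      ((C * (2 * Real.pi * τ) ^ ((Fintype.card ι : ℝ) / 2) : ℝ) : ℂ) *
      (Complex.exp ((inner ℝ t m : ℝ) * Complex.I) *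
        Complex.exp (Complex.I ^ 2 * (‖t‖ : ℂ) ^ 2 / (4 * ((1 / (2 * τ) : ℝ) : ℂ)))) by
      push_cast; ring]
  rw [hC, one_div_mul_cancel hne, Complex.ofReal_one, one_mul, ← Complex.exp_add]
  congr 1
  have hdot : t.ofLp ⬝ᵥ (τ • (1 : Matrix ι ι ℝ)) *ᵥ t.ofLp = τ * ‖t‖ ^ 2 := by
    rw [Matrix.smul_mulVec, Matrix.one_mulVec, dotProduct_smul, EuclideanSpace.real_norm_sq_eq,
      smul_eq_mul]
    simp [dotProduct, sq]
  rw [hdot, Complex.I_sq]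
  push_cast
  field_simp
  ring

lemma map_smul_add_multivariateGaussian [DecidableEq ι] {τ : ℝ} (hτ : 0 ≤ τ) (σ : ℝ)
    (v : EuclideanSpace ℝ ι) :
    (multivariateGaussian 0 (τ • (1 : Matrix ι ι ℝ))).map (fun w => σ • w + v) =
      multivariateGaussian v ((σ ^ 2 * τ) • (1 : Matrix ι ι ℝ)) := by
  have : (fun w : EuclideanSpace ℝ ι => σ • w + v) = (fun w => w + v) ∘ fun w => σ • w := rfl
  have hfin : IsProbabilityMeasure ((multivariateGaussian 0 (τ • (1 : Matrix ι ι ℝ))).map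
    (fun w => σ • w + v)) := Measure.isProbabilityMeasure_map (by fun_prop)
  refine Measure.ext_of_charFun ?_
  ext t
  rw [this, ← Measure.map_map (by fun_prop) (by fun_prop), charFun_map_add_const,
    charFun_map_smul, charFun_multivariateGaussian (Matrix.PosSemidef.one.smul hτ),
    charFun_multivariateGaussian (Matrix.PosSemidef.one.smul (by positivity)), ← Complex.exp_add]
  congr 1
  simp [Matrix.smul_mulVec, real_inner_comm]
  ring

lemma isoDensity_nonneg {τ : ℝ} (hτ : 0 ≤ τ) (m x : EuclideanSpace ℝ ι) : 0 ≤ isoDensity τ m x := by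
  unfold isoDensity; positivity

lemma continuous_isoDensity (τ : ℝ) :
    Continuous fun y : EuclideanSpace ℝ ι × EuclideanSpace ℝ ι => isoDensity τ y.1 y.2 := by
  unfold isoDensity; fun_prop

end Density

/-! ### Disintegration of data and perturbation along the score -/

section Disintegration

variable {ι κ : Type*} [Fintype ι] [Fintype κ]
  (L : EuclideanSpace ℝ ι →L[ℝ] EuclideanSpace ℝ κ) {ν σ τ : ℝ}

/-- The perturbed score `σ w - ν⁻² L† x`. -/
def score (ν σ : ℝ) (y : EuclideanSpace ℝ κ × EuclideanSpace ℝ ι) : EuclideanSpace ℝ ι :=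
  σ • y.2 - scaledAdjoint L ν y.1

lemma continuous_score : Continuous (score L ν σ) := by unfold score; fun_prop

lemma lintegral_expLaw_translate {q : EuclideanSpace ℝ κ → ℝ} (hq : Measurable q)
    {f : EuclideanSpace ℝ κ → ℝ≥0∞} (hf : Measurable f) (m : EuclideanSpace ℝ κ) :
    ∫⁻ z, f (z + m) ∂(expLaw q) =
      ∫⁻ x, ENNReal.ofReal ((∫ y, Real.exp (-(q y / 2)))⁻¹ * Real.exp (-(q (x - m) / 2))) * f x := by
  rw [expLaw, lintegral_withDensity_eq_lintegral_mul _ (by fun_prop) (by fun_prop),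
    ← lintegral_add_right_eq_self (fun x => ENNReal.ofReal
      ((∫ y, Real.exp (-(q y / 2)))⁻¹ * Real.exp (-(q (x - m) / 2))) * f x) m]
  simp

/-- The joint density of the data and the perturbed score, as conditional density times marginal
density. -/
lemma exists_isoDensity_mul_isoDensity_eq (hν : 0 < ν) (hs : 0 < σ ^ 2 * τ)
    (θ : EuclideanSpace ℝ ι) :
    ∃ g : EuclideanSpace ℝ ι → ℝ, Measurable g ∧ (∀ u, 0 < g u) ∧
      ∀ u x, isoDensity (ν ^ 2) (L θ) x * isoDensity (σ ^ 2 * τ) (-scaledAdjoint L ν x) u =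
        g u * ((∫ y, Real.exp (-(precision L ν (σ ^ 2 * τ) y / 2)))⁻¹ *
          Real.exp (-(precision L ν (σ ^ 2 * τ) (x - condMean L ν (σ ^ 2 * τ) θ u) / 2))) := by
  set s := σ ^ 2 * τ with hs'
  set N := ∫ y, Real.exp (-(precision L ν s y / 2)) with hN
  have hN0 : 0 < N := integral_exp_pos (integrable_exp_precision L hν hs)
  refine ⟨fun u => 1 / (2 * Real.pi * ν ^ 2) ^ ((Fintype.card κ : ℝ) / 2) *
    (1 / (2 * Real.pi * s) ^ ((Fintype.card ι : ℝ) / 2)) * N *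
    Real.exp (-(inner ℝ (u + scaledAdjoint L ν (L θ))
          (scoreCovInv L ν s (u + scaledAdjoint L ν (L θ))) / 2)), ?_, fun u => by positivity,
    fun u x => ?_⟩
  · have : Continuous (scoreCovInv L ν s) := LinearMap.continuous_of_finiteDimensional _
    exact Continuous.measurable (by fun_prop)
  · have h := complete_square L (ν := ν) hs θ u x
    have e : Real.exp (-(‖x - L θ‖ ^ 2 / (2 * ν ^ 2))) *
        Real.exp (-(‖u + scaledAdjoint L ν x‖ ^ 2 / (2 * s))) =
        Real.exp (-(inner ℝ (u + scaledAdjoint L ν (L θ))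
          (scoreCovInv L ν s (u + scaledAdjoint L ν (L θ))) / 2)) *
        Real.exp (-(precision L ν s (x - condMean L ν s θ u) / 2)) := by
      rw [← Real.exp_add, ← Real.exp_add]
      congr 1
      have h1 : ‖x - L θ‖ ^ 2 / (2 * ν ^ 2) = ‖x - L θ‖ ^ 2 / ν ^ 2 / 2 := by field_simp
      have h2 : ‖u + scaledAdjoint L ν x‖ ^ 2 / (2 * s) =
        ‖u + scaledAdjoint L ν x‖ ^ 2 / s / 2 := by field_simp
      rw [h1, h2]
      linarith
    simp only [isoDensity, sub_neg_eq_add]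
    rw [mul_mul_mul_comm, e]
    field_simp

/-- Disintegration of the joint law of the data and the perturbed score: given the score `u`, the
data are distributed as a centred Gaussian translated by `condMean L ν s θ u`. -/
lemma lintegral_score [DecidableEq ι] [DecidableEq κ] (hν : 0 < ν) (hσ : 0 < σ) (hτ : 0 < τ)
    (θ : EuclideanSpace ℝ ι)
    {F : EuclideanSpace ℝ κ × EuclideanSpace ℝ ι → ℝ≥0∞} (hF : Measurable F) :
    ∫⁻ y, F (y.1, score L ν σ y)
      ∂((multivariateGaussian (L θ) (ν ^ 2 • (1 : Matrix κ κ ℝ))).prod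
        (multivariateGaussian 0 (τ • (1 : Matrix ι ι ℝ)))) =
      ∫⁻ u, ∫⁻ z, F (z + condMean L ν (σ ^ 2 * τ) θ u, u)
        ∂(expLaw (precision L ν (σ ^ 2 * τ)))
      ∂(((multivariateGaussian (L θ) (ν ^ 2 • (1 : Matrix κ κ ℝ))).prod
        (multivariateGaussian 0 (τ • (1 : Matrix ι ι ℝ)))).map (score L ν σ)) := by
  set s := σ ^ 2 * τ with hs'
  have hs : 0 < s := by positivity
  obtain ⟨g, hgm, hg0, hg⟩ := exists_isoDensity_mul_isoDensity_eq L (ν := ν) hν hs θ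
  have hiso1 := continuous_isoDensity (ι := κ) (ν ^ 2)
  have hiso2 := continuous_isoDensity (ι := ι) s
  have hcm : Continuous fun u => condMean L ν s θ u :=
    (continuous_condMean L).comp (Continuous.prodMk_right θ)
  have hprob := isProbabilityMeasure_expLaw (integrable_exp_precision L (ν := ν) hν hs)
  -- Given `x`, the score is Gaussian with mean `-ν⁻² L† x` and covariance `s I`. Swapping the two
  -- integrals in the joint density puts `u` outside, with an unnormalized-looking weight `g`.
  have main : ∀ F : EuclideanSpace ℝ κ × EuclideanSpace ℝ ι → ℝ≥0∞, Measurable F →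
      ∫⁻ y, F (y.1, score L ν σ y)
        ∂((multivariateGaussian (L θ) (ν ^ 2 • (1 : Matrix κ κ ℝ))).prod
          (multivariateGaussian 0 (τ • (1 : Matrix ι ι ℝ)))) =
      ∫⁻ u, ENNReal.ofReal (g u) *
        ∫⁻ z, F (z + condMean L ν s θ u, u) ∂(expLaw (precision L ν s)) := by
    intro F hF
    have hsc := (continuous_score L (ν := ν) (σ := σ)).measurable
    rw [lintegral_prod _ (by fun_prop)]
    have inner : ∀ x, ∫⁻ w, F (x, score L ν σ (x, w))
        ∂(multivariateGaussian 0 (τ • (1 : Matrix ι ι ℝ))) =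
        ∫⁻ u, ENNReal.ofReal (isoDensity s (-scaledAdjoint L ν x) u) * F (x, u) := by
      intro x
      have h1 : ∫⁻ w, F (x, score L ν σ (x, w))
          ∂(multivariateGaussian 0 (τ • (1 : Matrix ι ι ℝ))) =
          ∫⁻ u, F (x, u) ∂((multivariateGaussian 0 (τ • (1 : Matrix ι ι ℝ))).map
            fun w => σ • w + -scaledAdjoint L ν x) := by
        rw [lintegral_map (by fun_prop) (by fun_prop)]
        simp only [score, sub_eq_add_neg]
      have h2 : Measurable (isoDensity s (-scaledAdjoint L ν x)) := by
        exact (hiso2.comp (Continuous.prodMk_right _)).measurable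
      rw [h1, map_smul_add_multivariateGaussian hτ.le, ← hs',
        multivariateGaussian_smul_one_eq_withDensity hs,
        lintegral_withDensity_eq_lintegral_mul _ (by fun_prop) (by fun_prop)]
      rfl
    simp_rw [inner]
    have h3 : Measurable (isoDensity (ν ^ 2) (L θ)) :=
      (hiso1.comp (Continuous.prodMk_right _)).measurable
    have h4 : Measurable fun y : EuclideanSpace ℝ κ × EuclideanSpace ℝ ι =>
        isoDensity s (-scaledAdjoint L ν y.1) y.2 :=
      (hiso2.comp (by fun_prop :
        Continuous fun y : EuclideanSpace ℝ κ × EuclideanSpace ℝ ι =>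
          (-scaledAdjoint L ν y.1, y.2))).measurable
    have h5 : Measurable fun x => ∫⁻ u, ENNReal.ofReal
        (isoDensity s (-scaledAdjoint L ν x) u) * F (x, u) :=
      Measurable.lintegral_prod_right' (f := fun y : EuclideanSpace ℝ κ × EuclideanSpace ℝ ι =>
        ENNReal.ofReal (isoDensity s (-scaledAdjoint L ν y.1) y.2) * F y) (by fun_prop)
    rw [multivariateGaussian_smul_one_eq_withDensity (by positivity : 0 < ν ^ 2),
      lintegral_withDensity_eq_lintegral_mul _ (by fun_prop) h5]
    simp only [Pi.mul_apply]
    have h6 : ∀ x, ENNReal.ofReal (isoDensity (ν ^ 2) (L θ) x) *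
        ∫⁻ u, ENNReal.ofReal (isoDensity s (-scaledAdjoint L ν x) u) * F (x, u) =
        ∫⁻ u, ENNReal.ofReal (isoDensity (ν ^ 2) (L θ) x) *
          (ENNReal.ofReal (isoDensity s (-scaledAdjoint L ν x) u) * F (x, u)) := by
      intro x
      have : Measurable fun u => ENNReal.ofReal (isoDensity s (-scaledAdjoint L ν x) u)
          * F (x, u) := by
        have h2 : Measurable (isoDensity s (-scaledAdjoint L ν x)) := by
          exact (hiso2.comp (Continuous.prodMk_right _)).measurable
        fun_prop
      rw [lintegral_const_mul _ this]
    simp_rw [h6]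
    rw [lintegral_lintegral_swap]
    · refine lintegral_congr fun u => ?_
      have hFu : Measurable fun x => F (x, u) := by fun_prop
      rw [lintegral_expLaw_translate (continuous_precision L).measurable hFu,
        ← lintegral_const_mul]
      · refine lintegral_congr fun x => ?_
        rw [← mul_assoc, ← mul_assoc, ← ENNReal.ofReal_mul (isoDensity_nonneg (by positivity) _ _),
          hg, ENNReal.ofReal_mul (hg0 u).le]
      · have := (continuous_precision L (ν := ν) (s := s)).measurable
        fun_prop
    · exact Measurable.aemeasurable (by fun_prop)
  have hsc := (continuous_score L (ν := ν) (σ := σ)).measurable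
  have hG : Measurable fun u => ∫⁻ z, F (z + condMean L ν s θ u, u)
      ∂(expLaw (precision L ν s)) :=
    Measurable.lintegral_prod_right' (f := fun y : EuclideanSpace ℝ ι × EuclideanSpace ℝ κ =>
      F (y.2 + condMean L ν s θ y.1, y.1)) (by have := hcm.measurable; fun_prop)
  -- Applying `main` a second time, to a function of `u` alone, identifies `g` as the density of the
  -- score: the inner integral is then against a probability measure. Thus `g` is never computed.
  rw [lintegral_map hG hsc, main F hF]
  rw [main (fun y => ∫⁻ z, F (z + condMean L ν s θ y.2, y.2)
      ∂(expLaw (precision L ν s))) (hG.comp measurable_snd)]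
  simp

end Disintegration

/-! ### Farkas' lemma -/

section Farkas

variable {E ι : Type*} [NormedAddCommGroup E] [InnerProductSpace ℝ E]

/-- Farkas' lemma for finitely many linear inequalities. -/
lemma farkas [DecidableEq ι] (s : Finset ι) : ∀ (a : ι → E) (γ : E),
    (∀ x, (∀ i ∈ s, inner ℝ (a i) x ≤ 0) → inner ℝ γ x ≤ 0) →
    ∃ lam : ι → ℝ, (∀ i, 0 ≤ lam i) ∧ (∀ i, i ∉ s → lam i = 0) ∧ γ = ∑ i ∈ s, lam i • a i := by
  induction s using Finset.induction_on with
  | empty =>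
    intro a γ h
    refine ⟨0, by simp, by simp, ?_⟩
    have h1 := h γ (by simp)
    have h2 : inner ℝ γ γ = 0 := le_antisymm h1 real_inner_self_nonneg
    simpa using h2
  | insert j s hj ih =>
    intro a γ h
    by_cases hc : ∀ x, (∀ i ∈ s, inner ℝ (a i) x ≤ 0) → inner ℝ γ x ≤ 0
    · obtain ⟨lam, h1, h2, h3⟩ := ih a γ hc
      refine ⟨lam, h1, fun i hi => h2 i fun his => hi (Finset.mem_insert_of_mem his), ?_⟩
      rw [Finset.sum_insert hj, h2 j hj, zero_smul, zero_add, h3]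
    · push Not at hc
      -- The direction `y` violates the claim for `s` alone, so the constraint `j` must exclude it.
      -- Projecting along `y` onto the hyperplane `⟪a j, x⟫ = 0` removes constraint `j`; the
      -- induction hypothesis applies to the adjointly projected vectors.
      obtain ⟨y, hy, hγ⟩ := hc
      have hjy : 0 < inner ℝ (a j) y := by
        by_contra hle
        refine absurd (h y fun i hi => ?_) (not_le.2 hγ)
        rcases Finset.mem_insert.1 hi with rfl | hi
        · exact not_lt.1 hle
        · exact hy i hi
      set t := inner ℝ (a j) y with ht
      obtain ⟨lam, h1, h2, h3⟩ := ih (fun i => a i - (inner ℝ (a i) y / t) • a j)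
        (γ - (inner ℝ γ y / t) • a j) (by
          intro x hx
          have key : ∀ v : E, inner ℝ (v - (inner ℝ v y / t) • a j) x =
              inner ℝ v (x - (inner ℝ (a j) x / t) • y) := by
            intro v
            rw [inner_sub_left, inner_sub_right, real_inner_smul_left, real_inner_smul_right]
            ring
          rw [key]
          refine h _ fun i hi => ?_
          rcases Finset.mem_insert.1 hi with rfl | hi
          · rw [inner_sub_right, real_inner_smul_right, ← ht, div_mul_cancel₀ _ hjy.ne', sub_self]
          · rw [← key]; exact hx i hi)
      -- This is the coefficient of `a j` after undoing the projection; its sign comes from `⟪γ, y⟫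
      -- > 0` and `⟪a i, y⟫ ≤ 0` on `s`.
      have hsum : 0 ≤ inner ℝ γ y / t - ∑ i ∈ s, lam i * (inner ℝ (a i) y / t) := by
        have : ∑ i ∈ s, lam i * (inner ℝ (a i) y / t) ≤ 0 :=
          Finset.sum_nonpos fun i hi => mul_nonpos_of_nonneg_of_nonpos (h1 i)
            (div_nonpos_of_nonpos_of_nonneg (hy i hi) hjy.le)
        have h0 : 0 < inner ℝ γ y / t := div_pos hγ hjy
        linarith
      refine ⟨Function.update lam j (inner ℝ γ y / t - ∑ i ∈ s, lam i * (inner ℝ (a i) y / t)),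
        fun i => ?_, fun i hi => ?_, ?_⟩
      · by_cases hij : i = j
        · subst hij; simpa using hsum
        · simpa [hij] using h1 i
      · rw [Finset.mem_insert, not_or] at hi
        rw [Function.update_of_ne hi.1]; exact h2 i hi.2
      · have hupd : ∀ r : ℝ, ∑ i ∈ s, Function.update lam j r i • a i = ∑ i ∈ s, lam i • a i :=
          fun r => Finset.sum_congr rfl fun i hi => by
            rw [Function.update_of_ne (by rintro rfl; exact hj hi)]
        rw [Finset.sum_insert hj, Function.update_self, hupd]
        have h4 : γ = ∑ i ∈ s, lam i • (a i - (inner ℝ (a i) y / t) • a j)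
          + (inner ℝ γ y / t) • a j := by rw [← h3]; abel
        refine h4.trans ?_
        simp only [smul_sub, Finset.sum_sub_distrib, smul_smul, sub_smul, Finset.sum_smul]
        abel

end Farkas

/-! ### Strongly convex minimization over closed convex sets -/

lemma hasDerivAt_line {E : Type*} [NormedAddCommGroup E] [NormedSpace ℝ E] (y v : E) (t : ℝ) :
    HasDerivAt (fun t : ℝ => y + t • v) v t := by
  simpa using ((hasDerivAt_id t).smul_const v).const_add y

section StronglyConvex

variable {E : Type*} [NormedAddCommGroup E] [InnerProductSpace ℝ E] [CompleteSpace E]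

/-- `G` is differentiable with gradient `G'`, and `G'` is strongly monotone with modulus `c`. -/
structure IsStronglyConvexWith (G : E → ℝ) (G' : E → E) (c : ℝ) : Prop where
  pos : 0 < c
  hasGradientAt : ∀ θ, HasGradientAt G (G' θ) θ
  continuous_grad : Continuous G'
  strongMono : ∀ x y, c * ‖x - y‖ ^ 2 ≤ inner ℝ (G' x - G' y) (x - y)

lemma IsStronglyConvexWith.of_fderiv {G : E → ℝ} {G' : E → E} {c : ℝ} (hc : 0 < c)
    (hG : ∀ θ, HasGradientAt G (G' θ) θ) (hG' : Differentiable ℝ G')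
    (h : ∀ θ v, c * ‖v‖ ^ 2 ≤ inner ℝ (fderiv ℝ G' θ v) v) : IsStronglyConvexWith G G' c where
  pos := hc
  hasGradientAt := hG
  continuous_grad := hG'.continuous
  strongMono x y := by
    set v := x - y with hv
    have hd : ∀ t : ℝ, HasDerivAt (fun t : ℝ => inner ℝ (G' (y + t • v)) v - c * ‖v‖ ^ 2 * t)
        (inner ℝ (fderiv ℝ G' (y + t • v) v) v - c * ‖v‖ ^ 2) t := by
      intro t
      have h1 : HasDerivAt (fun t : ℝ => G' (y + t • v)) (fderiv ℝ G' (y + t • v) v) t :=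
        (hG' (y + t • v)).hasFDerivAt.comp_hasDerivAt t (hasDerivAt_line y v t)
      have h2 := (h1.inner ℝ (hasDerivAt_const t v)).sub
        ((hasDerivAt_id t).const_mul (c * ‖v‖ ^ 2))
      exact HasDerivAt.congr_deriv h2 (by simp)
    have hmono := monotone_of_deriv_nonneg (fun t => (hd t).differentiableAt)
      (fun t => by rw [(hd t).deriv]; linarith [h (y + t • v) v])
    have := hmono (zero_le_one' ℝ)
    simp only [zero_smul, add_zero, mul_zero, sub_zero, one_smul, mul_one] at this
    rw [inner_sub_left]
    rw [hv, add_sub_cancel, ← hv] at this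
    linarith

namespace IsStronglyConvexWith

variable {G : E → ℝ} {G' : E → E} {c : ℝ}

lemma add_linear (h : IsStronglyConvexWith G G' c) (u : E) :
    IsStronglyConvexWith (fun θ => G θ + inner ℝ u θ) (fun θ => G' θ + u) c where
  pos := h.pos
  hasGradientAt θ := by
    have h1 := (h.hasGradientAt θ).hasFDerivAt
    have h2 := (innerSL ℝ u).hasFDerivAt (x := θ)
    rw [hasGradientAt_iff_hasFDerivAt, map_add]
    exact h1.add h2
  continuous_grad := h.continuous_grad.add_const u
  strongMono x y := by simpa using h.strongMono x y

lemma continuous (h : IsStronglyConvexWith G G' c) : Continuous G :=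
  continuous_iff_continuousAt.2 fun θ => (h.hasGradientAt θ).continuousAt

lemma lower_bound (h : IsStronglyConvexWith G G' c) (x y : E) :
    G y + inner ℝ (G' y) (x - y) + c / 2 * ‖x - y‖ ^ 2 ≤ G x := by
  set v := x - y with hv
  have hd : ∀ t : ℝ, HasDerivAt
      (fun t : ℝ => G (y + t • v) - inner ℝ (G' y) v * t - c / 2 * ‖v‖ ^ 2 * t ^ 2)
      (inner ℝ (G' (y + t • v) - G' y) v - c * ‖v‖ ^ 2 * t) t := by
    intro t
    have h1 : HasDerivAt (fun t : ℝ => G (y + t • v)) (inner ℝ (G' (y + t • v)) v) t := by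
      have := (h.hasGradientAt (y + t • v)).hasFDerivAt.comp_hasDerivAt t (hasDerivAt_line y v t)
      simpa [Function.comp_def] using this
    have h2 := (h1.sub ((hasDerivAt_id t).const_mul (inner ℝ (G' y) v))).sub
      ((hasDerivAt_pow 2 t).const_mul (c / 2 * ‖v‖ ^ 2))
    refine HasDerivAt.congr_deriv h2 ?_
    rw [inner_sub_left]; push_cast; ring
  have hmono : MonotoneOn
      (fun t : ℝ => G (y + t • v) - inner ℝ (G' y) v * t - c / 2 * ‖v‖ ^ 2 * t ^ 2)
      (Set.Ici 0) := by
    refine monotoneOn_of_deriv_nonneg (convex_Ici 0)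
      (fun t _ => (hd t).continuousAt.continuousWithinAt)
      (fun t _ => (hd t).differentiableAt.differentiableWithinAt) fun t ht => ?_
    rw [interior_Ici] at ht
    have ht0 : 0 < t := ht
    rw [(hd t).deriv]
    have := h.strongMono (y + t • v) y
    rw [add_sub_cancel_left, real_inner_smul_right, norm_smul, Real.norm_eq_abs,
      abs_of_pos ht0] at this
    have h3 : t * (c * ‖v‖ ^ 2 * t) ≤ t * inner ℝ (G' (y + t • v) - G' y) v := by
      calc _ = c * (t * ‖v‖) ^ 2 := by ring
        _ ≤ _ := this
    linarith [le_of_mul_le_mul_left h3 ht0]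
  have := hmono (Set.mem_Ici.2 le_rfl) (Set.mem_Ici.2 zero_le_one) (zero_le_one' ℝ)
  simp only [zero_smul, add_zero, mul_zero, sub_zero, one_smul, mul_one, one_pow, ne_eq,
    OfNat.ofNat_ne_zero, not_false_eq_true, zero_pow] at this
  rw [hv, add_sub_cancel, ← hv] at this
  linarith

lemma exists_isMinOn [FiniteDimensional ℝ E] (h : IsStronglyConvexWith G G' c) {C : Set E}
    (hC : IsClosed C) (hne : C.Nonempty) : ∃ θ ∈ C, IsMinOn G C θ := by
  obtain ⟨y, hy⟩ := hne
  have hc := h.pos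
  -- Beyond this radius the quadratic term of `lower_bound` dominates the linear one, so `G` is at
  -- least `G y` there and a minimizer over the ball is global.
  set r := 2 * ‖G' y‖ / c with hr
  have hr0 : 0 ≤ r := by positivity
  obtain ⟨θ, hθ, hmin⟩ := ((isCompact_closedBall y r).inter_left hC).exists_isMinOn
    ⟨y, hy, Metric.mem_closedBall_self hr0⟩ h.continuous.continuousOn
  refine ⟨θ, hθ.1, fun x hx => ?_⟩
  by_cases hxr : x ∈ Metric.closedBall y r
  · exact hmin ⟨hx, hxr⟩
  · have h1 : G θ ≤ G y := hmin ⟨hy, Metric.mem_closedBall_self hr0⟩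
    rw [Metric.mem_closedBall, not_le, dist_eq_norm, hr, div_lt_iff₀ hc] at hxr
    have h2 := h.lower_bound x y
    have h3 := abs_real_inner_le_norm (G' y) (x - y)
    have h4 := neg_abs_le (inner ℝ (G' y) (x - y))
    have h5 : 0 ≤ ‖x - y‖ * (c / 2 * ‖x - y‖ - ‖G' y‖) :=
      mul_nonneg (norm_nonneg _) (by linarith)
    change G θ ≤ G x
    nlinarith

lemma inner_grad_nonneg (h : IsStronglyConvexWith G G' c) {C : Set E} (hC : Convex ℝ C) {θ x : E}
    (hθ : θ ∈ C) (hmin : IsMinOn G C θ) (hx : x ∈ C) : 0 ≤ inner ℝ (G' θ) (x - θ) := by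
  have h1 := hmin.localize.hasFDerivWithinAt_nonneg
    (h.hasGradientAt θ).hasFDerivAt.hasFDerivWithinAt
    (sub_mem_posTangentConeAt_of_segment_subset (hC.segment_subset hθ hx))
  simpa using h1

end IsStronglyConvexWith

/-- A minimizer of the linear perturbation `G + ⟪u, ·⟫` over `C`, when there is one. -/
def tiltedArgmin (G : E → ℝ) (C : Set E) (u : E) : E :=
  Classical.epsilon fun θ => θ ∈ C ∧ IsMinOn (fun t => G t + inner ℝ u t) C θ

namespace IsStronglyConvexWith

variable {G : E → ℝ} {G' : E → E} {c : ℝ} [FiniteDimensional ℝ E]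

lemma tiltedArgmin_spec (h : IsStronglyConvexWith G G' c) {C : Set E}
    (hC : IsClosed C) (hne : C.Nonempty) (u : E) :
    tiltedArgmin G C u ∈ C ∧ IsMinOn (fun t => G t + inner ℝ u t) C (tiltedArgmin G C u) := by
  obtain ⟨θ, h1, h2⟩ := (h.add_linear u).exists_isMinOn hC hne
  exact Classical.epsilon_spec
    (p := fun θ => θ ∈ C ∧ IsMinOn (fun t => G t + inner ℝ u t) C θ) ⟨θ, h1, h2⟩

/-- Test each minimizer's variational inequality against the other minimizer and add; strong
monotonicity absorbs the gradients. The resulting Lipschitz bound makes the estimator measurable,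
although it is defined by a choice. -/
lemma norm_tiltedArgmin_sub_le (h : IsStronglyConvexWith G G' c) {C : Set E}
    (hC : IsClosed C) (hconv : Convex ℝ C) (hne : C.Nonempty) (u v : E) :
    c * ‖tiltedArgmin G C u - tiltedArgmin G C v‖ ≤ ‖u - v‖ := by
  obtain ⟨hu1, hu2⟩ := h.tiltedArgmin_spec hC hne u
  obtain ⟨hv1, hv2⟩ := h.tiltedArgmin_spec hC hne v
  set x := tiltedArgmin G C u
  set y := tiltedArgmin G C v
  have h1 := (h.add_linear u).inner_grad_nonneg hconv hu1 hu2 hv1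
  have h2 := (h.add_linear v).inner_grad_nonneg hconv hv1 hv2 hu1
  have h3 := h.strongMono x y
  have h4 := (abs_le.1 (abs_real_inner_le_norm (u - v) (x - y))).1
  have h5 : c * ‖x - y‖ ^ 2 ≤ ‖u - v‖ * ‖x - y‖ := by
    simp only [inner_add_left, inner_sub_left, inner_sub_right] at *
    linarith
  rcases (norm_nonneg (x - y)).eq_or_lt with h0 | h0
  · rw [← h0, mul_zero]; positivity
  · exact le_of_mul_le_mul_right (by linarith) h0

lemma continuous_tiltedArgmin (h : IsStronglyConvexWith G G' c) {C : Set E}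
    (hC : IsClosed C) (hconv : Convex ℝ C) (hne : C.Nonempty) :
    Continuous (tiltedArgmin G C) := by
  refine (LipschitzWith.of_dist_le_mul (K := ⟨c⁻¹, (inv_pos.2 h.pos).le⟩) fun u v => ?_).continuous
  rw [dist_eq_norm, dist_eq_norm]
  change _ ≤ c⁻¹ * _
  rw [inv_mul_eq_div, le_div_iff₀ h.pos, mul_comm]
  exact h.norm_tiltedArgmin_sub_le hC hconv hne u v

end IsStronglyConvexWith

end StronglyConvex

/-! ### Polyhedra and Karush–Kuhn–Tucker multipliers -/

section KKT

variable {E : Type*} [NormedAddCommGroup E] [InnerProductSpace ℝ E] {ι : Type*}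

lemma isClosed_polyhedron (a : ι → E) (b : ι → ℝ) : IsClosed {θ | ∀ i, inner ℝ (a i) θ ≤ b i} := by
  rw [Set.ofPred_forall]
  exact isClosed_iInter fun i => isClosed_le (by fun_prop) continuous_const

lemma convex_polyhedron (a : ι → E) (b : ι → ℝ) : Convex ℝ {θ | ∀ i, inner ℝ (a i) θ ≤ b i} := by
  rw [Set.ofPred_forall]
  exact convex_iInter fun i => convex_halfSpace_le
    ⟨fun x y => inner_add_right _ x y, fun r x => by simp [real_inner_smul_right]⟩ _

/-- The Karush–Kuhn–Tucker conditions for a first-order stationary point of a polyhedron. -/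
lemma exists_multipliers [Fintype ι] (a : ι → E) (b : ι → ℝ) {θ g : E}
    (hθ : ∀ i, inner ℝ (a i) θ ≤ b i)
    (hg : ∀ x, (∀ i, inner ℝ (a i) x ≤ b i) → 0 ≤ inner ℝ g (x - θ)) :
    ∃ lam : ι → ℝ, (∀ i, 0 ≤ lam i) ∧ (∀ i, inner ℝ (a i) θ ≠ b i → lam i = 0) ∧
      g + ∑ i, lam i • a i = 0 := by
  classical
  obtain ⟨lam, h1, h2, h3⟩ := farkas (Finset.univ.filter fun i => inner ℝ (a i) θ = b i) a (-g) (by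
    intro v hv
    -- A direction allowed by the active constraints stays feasible for small steps, since inactive
    -- constraints have slack and are finitely many. Hence stationarity gives Farkas' hypothesis for
    -- `-g`.
    have hev : ∀ᶠ t : ℝ in nhdsWithin 0 (Set.Ioi 0), ∀ i, inner ℝ (a i) (θ + t • v) ≤ b i := by
      refine Filter.eventually_all.2 fun i => ?_
      by_cases hi : inner ℝ (a i) θ = b i
      · filter_upwards [self_mem_nhdsWithin] with t ht
        have ht0 : 0 < t := ht
        have := hv i (by simpa using hi)
        rw [inner_add_right, real_inner_smul_right, hi]
        nlinarith
      · have hlt := lt_of_le_of_ne (hθ i) hi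
        have hcont : Continuous fun t : ℝ => inner ℝ (a i) (θ + t • v) := by fun_prop
        have h0 : Filter.Tendsto (fun t : ℝ => inner ℝ (a i) (θ + t • v)) (nhds 0)
            (nhds (inner ℝ (a i) θ)) := by simpa using hcont.tendsto 0
        exact ((h0.mono_left nhdsWithin_le_nhds).eventually_lt_const hlt).mono fun _ h => h.le
    obtain ⟨t, ht, ht0⟩ := (hev.and self_mem_nhdsWithin).exists
    have := hg _ ht
    rw [add_sub_cancel_left, real_inner_smul_right] at this
    rw [inner_neg_left]
    have := nonneg_of_mul_nonneg_right this (show 0 < t from ht0)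
    linarith)
  refine ⟨lam, h1, fun i hi => h2 i (by simpa using hi), ?_⟩
  have : ∑ i, lam i • a i = -g := by
    rw [h3, Finset.sum_filter]
    refine Finset.sum_congr rfl fun i _ => ?_
    split_ifs with hi
    · rfl
    · rw [h2 i (by simpa using hi), zero_smul]
  rw [this, add_neg_cancel]

end KKT

/-! ### Matrices, Hessians and the design map -/

section MatrixCalculus

variable {k n d : ℕ}

lemma of_apply_single_mulVec (T : EuclideanSpace ℝ (Fin d) →L[ℝ] EuclideanSpace ℝ (Fin d))
    (v : EuclideanSpace ℝ (Fin d)) :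
    (Matrix.of fun i j => (T (EuclideanSpace.single j 1)) i) *ᵥ v.ofLp = (T v).ofLp := by
  ext i
  have hv : v = ∑ j, v j • EuclideanSpace.single j (1 : ℝ) := by
    simpa using ((EuclideanSpace.basisFun (Fin d) ℝ).sum_repr v).symm
  conv_rhs => rw [hv]
  simp [Matrix.mulVec, dotProduct, mul_comm]

lemma hessian_mulVec (F : EuclideanSpace ℝ (Fin d) → ℝ) (θ v : EuclideanSpace ℝ (Fin d)) :
    hessian F θ *ᵥ v.ofLp = (fderiv ℝ (gradient F) θ v).ofLp :=
  of_apply_single_mulVec _ v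

lemma inner_row (A : Matrix (Fin k) (Fin d) ℝ) (i : Fin k) (θ : EuclideanSpace ℝ (Fin d)) :
    inner ℝ (row A i) θ = (A *ᵥ θ.ofLp) i := by
  simp [row, PiLp.inner_apply, Matrix.mulVec, dotProduct, mul_comm]

lemma orthoBasis_transpose_mul_self (A : Matrix (Fin k) (Fin d) ℝ) (S : Set (Fin k)) :
    (orthoBasis A S)ᵀ * orthoBasis A S = 1 := by
  ext i j
  have h := orthonormal_iff_ite.1 (stdOrthonormalBasis ℝ (rowsOrtho A S)).orthonormal j i
  rw [Submodule.coe_inner, PiLp.inner_apply] at h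
  simpa [Matrix.mul_apply, orthoBasis, Matrix.one_apply, eq_comm] using h

lemma posDef_orthoBasis_conj (A : Matrix (Fin k) (Fin d) ℝ) (S : Set (Fin k))
    {H : Matrix (Fin d) (Fin d) ℝ} (hH : H.PosDef) :
    ((orthoBasis A S)ᵀ * H * orthoBasis A S).PosDef := by
  rw [← Matrix.conjTranspose_eq_transpose_of_trivial]
  refine hH.conjTranspose_mul_mul_same fun x y hxy => ?_
  have := congrArg ((orthoBasis A S)ᵀ *ᵥ ·) hxy
  simpa [Matrix.mulVec_mulVec, orthoBasis_transpose_mul_self] using this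

/-- The design matrix as a continuous linear map. -/
def designMap (Z : Matrix (Fin n) (Fin d) ℝ) :
    EuclideanSpace ℝ (Fin d) →L[ℝ] EuclideanSpace ℝ (Fin n) :=
  LinearMap.toContinuousLinearMap (Matrix.toEuclideanLin Z)

lemma designMap_apply (Z : Matrix (Fin n) (Fin d) ℝ) (θ : EuclideanSpace ℝ (Fin d)) :
    designMap Z θ = linMean Z θ := rfl

lemma scaledAdjoint_designMap (Z : Matrix (Fin n) (Fin d) ℝ) (ν : ℝ)
    (x : EuclideanSpace ℝ (Fin n)) :
    (scaledAdjoint (designMap Z) ν x).ofLp = (1 / ν ^ 2) • (Zᵀ *ᵥ x.ofLp) := by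
  have h : (designMap Z).adjoint x = designMap Zᵀ x := by
    refine ext_inner_right ℝ fun y => ?_
    rw [ContinuousLinearMap.adjoint_inner_left, designMap_apply, designMap_apply]
    simp only [linMean, EuclideanSpace.inner_eq_star_dotProduct, star_trivial]
    rw [Matrix.mulVec_transpose, dotProduct_comm, Matrix.dotProduct_mulVec, dotProduct_comm]
  simp [scaledAdjoint, h, designMap_apply, linMean]

end MatrixCalculus

/-! ### The Gaussian loss as a function of the perturbed score -/

section GaussianProblem

variable {n d k : ℕ} (Z : Matrix (Fin n) (Fin d) ℝ) (ν : ℝ)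
  (R : EuclideanSpace ℝ (Fin d) → ℝ) (A : Matrix (Fin k) (Fin d) ℝ) (b : Fin k → ℝ) (σ : ℝ)

/-- The part of the regularized loss that depends on the parameter only. -/
def potential (θ : EuclideanSpace ℝ (Fin d)) : ℝ := ‖designMap Z θ‖ ^ 2 / (2 * ν ^ 2) + R θ

/-- The gradient of `potential`. -/
def potentialGrad (θ : EuclideanSpace ℝ (Fin d)) : EuclideanSpace ℝ (Fin d) :=
  scaledAdjoint (designMap Z) ν (designMap Z θ) + gradient R θ

variable {ν R}

lemma hasGradientAt_potential (hν : 0 < ν) (hR : Differentiable ℝ R)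
    (θ : EuclideanSpace ℝ (Fin d)) :
    HasGradientAt (potential Z ν R) (potentialGrad Z ν R θ) θ := by
  have h1 : HasFDerivAt (fun t => ‖designMap Z t‖ ^ 2) _ θ :=
    (designMap Z).hasFDerivAt.norm_sq
  have h2 := (h1.const_mul (1 / (2 * ν ^ 2))).add (hR θ).hasGradientAt.hasFDerivAt
  rw [hasGradientAt_iff_hasFDerivAt]
  have e : potential Z ν R = fun t => 1 / (2 * ν ^ 2) * ‖designMap Z t‖ ^ 2 + R t := by
    ext t; simp only [potential]; ring
  rw [e]
  refine HasFDerivAt.congr_fderiv h2 ?_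
  ext v
  simp [potentialGrad, inner_scaledAdjoint]
  field_simp

lemma hasFDerivAt_potentialGrad (hR' : Differentiable ℝ (gradient R))
    (θ : EuclideanSpace ℝ (Fin d)) :
    HasFDerivAt (potentialGrad Z ν R)
      ((scaledAdjoint (designMap Z) ν) ∘L (designMap Z) + fderiv ℝ (gradient R) θ) θ :=
  ((scaledAdjoint (designMap Z) ν) ∘L (designMap Z)).hasFDerivAt.add (hR' θ).hasFDerivAt

lemma fderiv_potentialGrad_matrix (hR' : Differentiable ℝ (gradient R))
    (θ v : EuclideanSpace ℝ (Fin d)) :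
    (fderiv ℝ (potentialGrad Z ν R) θ v).ofLp =
      ((1 / ν ^ 2) • (Zᵀ * Z) + hessian R θ) *ᵥ v.ofLp := by
  rw [(hasFDerivAt_potentialGrad Z hR' θ).fderiv, Matrix.add_mulVec, hessian_mulVec,
    Matrix.smul_mulVec, ← Matrix.mulVec_mulVec]
  simp [scaledAdjoint_designMap, designMap_apply, linMean]

lemma isStronglyConvexWith_potential (hν : 0 < ν) (hR : Differentiable ℝ R)
    (hR' : Differentiable ℝ (gradient R)) {c : ℝ} (hc : 0 < c)
    (hRc : ∀ θ : EuclideanSpace ℝ (Fin d),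
      ((1 / ν ^ 2) • (Zᵀ * Z) + hessian R θ - c • (1 : Matrix (Fin d) (Fin d) ℝ)).PosDef) :
    IsStronglyConvexWith (potential Z ν R) (potentialGrad Z ν R) c := by
  refine .of_fderiv hc (hasGradientAt_potential Z hν hR)
    (fun θ => (hasFDerivAt_potentialGrad Z hR' θ).differentiableAt) fun θ v => ?_
  have h := (hRc θ).posSemidef.dotProduct_mulVec_nonneg v.ofLp
  rw [Matrix.sub_mulVec, ← fderiv_potentialGrad_matrix Z hR', dotProduct_sub, Matrix.smul_mulVec,
    Matrix.one_mulVec, dotProduct_smul, star_trivial] at h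
  have h1 : v.ofLp ⬝ᵥ v.ofLp = ‖v‖ ^ 2 := by
    rw [EuclideanSpace.real_norm_sq_eq]; simp [dotProduct, sq]
  have h2 : v.ofLp ⬝ᵥ (fderiv ℝ (potentialGrad Z ν R) θ v).ofLp =
      inner ℝ (fderiv ℝ (potentialGrad Z ν R) θ v) v := by
    rw [EuclideanSpace.inner_eq_star_dotProduct, star_trivial]
  rw [h1, h2, smul_eq_mul] at h
  linarith

/-- The part of the loss that depends on the data only. -/
def lossOffset (ν : ℝ) (x : EuclideanSpace ℝ (Fin n)) : ℝ :=
  ‖x‖ ^ 2 / (2 * ν ^ 2) - Real.log (1 / (2 * Real.pi * ν ^ 2) ^ ((n : ℝ) / 2))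

lemma loss₀_eq (hν : 0 < ν) (x : EuclideanSpace ℝ (Fin n)) (θ : EuclideanSpace ℝ (Fin d)) :
    (gaussianProblem Z ν R A b σ).loss₀ θ x =
      potential Z ν R θ + inner ℝ (-scaledAdjoint (designMap Z) ν x) θ + lossOffset ν x := by
  simp only [Problem.loss₀, gaussianProblem, gaussianDensity, potential, lossOffset]
  rw [Real.log_mul (by positivity) (Real.exp_ne_zero _), Real.log_exp, ← designMap_apply,
    norm_sub_sq_real, inner_neg_left, inner_scaledAdjoint]
  field_simp
  ring

lemma loss_eq (hν : 0 < ν) (x : EuclideanSpace ℝ (Fin n)) (w θ : EuclideanSpace ℝ (Fin d)) :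
    (gaussianProblem Z ν R A b σ).loss θ x w =
      potential Z ν R θ + inner ℝ (score (designMap Z) ν σ (x, w)) θ + lossOffset ν x := by
  rw [Problem.loss, loss₀_eq Z A b σ hν]
  simp only [gaussianProblem, score, inner_sub_left, inner_neg_left, real_inner_smul_left]
  ring

lemma gradient_potential_add (hν : 0 < ν) (hR : Differentiable ℝ R)
    (u : EuclideanSpace ℝ (Fin d)) (C : ℝ) :
    gradient (fun θ => potential Z ν R θ + inner ℝ u θ + C) = fun θ => potentialGrad Z ν R θ + u := by
  ext1 θ
  refine HasGradientAt.gradient ?_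
  rw [hasGradientAt_iff_hasFDerivAt, map_add]
  exact ((hasGradientAt_potential Z hν hR θ).hasFDerivAt.add
    ((innerSL ℝ u).hasFDerivAt (x := θ))).add_const C

lemma gradient_loss (hν : 0 < ν) (hR : Differentiable ℝ R) (x : EuclideanSpace ℝ (Fin n))
    (w : EuclideanSpace ℝ (Fin d)) :
    gradient (fun t => (gaussianProblem Z ν R A b σ).loss t x w) =
      fun θ => potentialGrad Z ν R θ + score (designMap Z) ν σ (x, w) := by
  simp_rw [loss_eq Z A b σ hν]
  exact gradient_potential_add Z hν hR _ _

lemma gradient_loss₀ (hν : 0 < ν) (hR : Differentiable ℝ R) (x : EuclideanSpace ℝ (Fin n)) :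
    gradient (fun t => (gaussianProblem Z ν R A b σ).loss₀ t x) =
      fun θ => potentialGrad Z ν R θ + -scaledAdjoint (designMap Z) ν x := by
  simp_rw [loss₀_eq Z A b σ hν]
  exact gradient_potential_add Z hν hR _ _

/-- The Hessian of the regularized loss, which does not depend on the data. -/
def potentialHessian (ν : ℝ) (R : EuclideanSpace ℝ (Fin d) → ℝ) (θ : EuclideanSpace ℝ (Fin d)) :
    Matrix (Fin d) (Fin d) ℝ := (1 / ν ^ 2) • (Zᵀ * Z) + hessian R θ

lemma hessian_eq_of_gradient_eq (hR' : Differentiable ℝ (gradient R))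
    {F : EuclideanSpace ℝ (Fin d) → ℝ} {u : EuclideanSpace ℝ (Fin d)}
    (hF : gradient F = fun θ => potentialGrad Z ν R θ + u) (θ : EuclideanSpace ℝ (Fin d)) :
    hessian F θ = potentialHessian Z ν R θ := by
  refine Matrix.ext_of_mulVec_single fun j => ?_
  have h1 := hessian_mulVec F θ (EuclideanSpace.single j 1)
  rw [hF, fderiv_add_const, fderiv_potentialGrad_matrix Z hR'] at h1
  exact h1

lemma posDef_potentialHessian {c : ℝ} (hc : 0 < c) {θ : EuclideanSpace ℝ (Fin d)}
    (hRc : ((1 / ν ^ 2) • (Zᵀ * Z) + hessian R θ - c • (1 : Matrix (Fin d) (Fin d) ℝ)).PosDef) :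
    (potentialHessian Z ν R θ).PosDef := by
  have := hRc.add (Matrix.PosDef.one.smul hc)
  rwa [sub_add_cancel] at this

lemma feasible_eq : (gaussianProblem Z ν R A b σ).feasible = {θ | ∀ i, inner ℝ (row A i) θ ≤ b i} := by
  ext θ
  simp [Problem.feasible, gaussianProblem, inner_row]

/-- The estimator as a function of the perturbed score. -/
def scoreArgmin (ν : ℝ) (R : EuclideanSpace ℝ (Fin d) → ℝ) (u : EuclideanSpace ℝ (Fin d)) :
    EuclideanSpace ℝ (Fin d) :=
  tiltedArgmin (potential Z ν R) {θ | ∀ i, inner ℝ (row A i) θ ≤ b i} u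

/-- The gradient at the estimator as a function of the perturbed score. -/
def scoreGrad (ν : ℝ) (R : EuclideanSpace ℝ (Fin d) → ℝ) (u : EuclideanSpace ℝ (Fin d)) :
    EuclideanSpace ℝ (Fin d) :=
  potentialGrad Z ν R (scoreArgmin Z A b ν R u) + u

/-- The data-only offset cancels when losses are compared, so both choice operators receive the same
predicate; uniqueness of the minimizer plays no role. -/
lemma thetaHat_eq (hν : 0 < ν) (x : EuclideanSpace ℝ (Fin n)) (w : EuclideanSpace ℝ (Fin d)) :
    (gaussianProblem Z ν R A b σ).thetaHat x w =
      scoreArgmin Z A b ν R (score (designMap Z) ν σ (x, w)) := by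
  rw [Problem.thetaHat, scoreArgmin, tiltedArgmin]
  congr 1
  ext θ
  simp only [Problem.IsConstrainedMin, feasible_eq, isMinOn_iff, loss_eq Z A b σ hν,
    add_le_add_iff_right]

lemma gHat_eq (hν : 0 < ν) (hR : Differentiable ℝ R) (x : EuclideanSpace ℝ (Fin n))
    (w : EuclideanSpace ℝ (Fin d)) :
    (gaussianProblem Z ν R A b σ).gHat x w =
      scoreGrad Z A b ν R (score (designMap Z) ν σ (x, w)) := by
  rw [Problem.gHat, gradient_loss Z A b σ hν hR, thetaHat_eq Z A b σ hν, scoreGrad]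

variable {c : ℝ}

lemma continuous_scoreArgmin (h : IsStronglyConvexWith (potential Z ν R) (potentialGrad Z ν R) c)
    (hne : {θ | ∀ i, inner ℝ (row A i) θ ≤ b i}.Nonempty) :
    Continuous (scoreArgmin Z A b ν R) :=
  h.continuous_tiltedArgmin (isClosed_polyhedron _ _) (convex_polyhedron _ _) hne

lemma continuous_scoreGrad (h : IsStronglyConvexWith (potential Z ν R) (potentialGrad Z ν R) c)
    (hne : {θ | ∀ i, inner ℝ (row A i) θ ≤ b i}.Nonempty) :
    Continuous (scoreGrad Z A b ν R) :=
  (h.continuous_grad.comp (continuous_scoreArgmin Z A b h hne)).add continuous_id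

/-- The multipliers come from the variational inequality at the minimizer; the second-order
condition is automatic because the full Hessian is positive definite. The procedure therefore always
draws copies from the sampler. -/
lemma isSSOSP_thetaHat (hν : 0 < ν) (hR : Differentiable ℝ R) (hR' : Differentiable ℝ (gradient R))
    (hc : 0 < c) (hRc : ∀ θ : EuclideanSpace ℝ (Fin d),
      ((1 / ν ^ 2) • (Zᵀ * Z) + hessian R θ - c • (1 : Matrix (Fin d) (Fin d) ℝ)).PosDef)
    (hne : {θ | ∀ i, inner ℝ (row A i) θ ≤ b i}.Nonempty)
    (x : EuclideanSpace ℝ (Fin n)) (w : EuclideanSpace ℝ (Fin d)) :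
    (gaussianProblem Z ν R A b σ).IsSSOSP x w ((gaussianProblem Z ν R A b σ).thetaHat x w) := by
  have hconv := isStronglyConvexWith_potential Z hν hR hR' hc hRc
  set u := score (designMap Z) ν σ (x, w) with hu
  obtain ⟨h1, h2⟩ := hconv.tiltedArgmin_spec (isClosed_polyhedron (row A) b) hne u
  rw [thetaHat_eq Z A b σ hν, ← hu]
  refine ⟨by rw [feasible_eq]; exact h1, ?_, ?_⟩
  · obtain ⟨lam, l1, l2, l3⟩ := exists_multipliers (row A) b (θ := scoreArgmin Z A b ν R u)
      (g := scoreGrad Z A b ν R u) h1 fun x hx =>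
        (hconv.add_linear u).inner_grad_nonneg (convex_polyhedron _ _) h1 h2 hx
    refine ⟨lam, l1, fun i hi => l2 i ?_, ?_⟩
    · rw [inner_row]; exact hi
    · rw [gradient_loss Z A b σ hν hR]; exact l3
  · rw [hessian_eq_of_gradient_eq Z hR' (gradient_loss Z A b σ hν hR x w)]
    exact posDef_orthoBasis_conj _ _ (posDef_potentialHessian Z hc (hRc _))

end GaussianProblem

/-! ### Total variation and distance to exchangeability -/

section Exchangeability

variable {α ι : Type*} [MeasurableSpace α]

lemma bddAbove_tvDist (μ ν : Measure α) [IsProbabilityMeasure μ] [IsProbabilityMeasure ν] :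
    BddAbove (Set.range fun B : {B : Set α // MeasurableSet B} => |μ.real B.1 - ν.real B.1|) := by
  refine ⟨1, ?_⟩
  rintro _ ⟨B, rfl⟩
  have h1 := measureReal_le_one (μ := μ) (s := B.1)
  have h2 := measureReal_le_one (μ := ν) (s := B.1)
  have h3 := measureReal_nonneg (μ := μ) (s := B.1)
  have h4 := measureReal_nonneg (μ := ν) (s := B.1)
  exact abs_le.2 ⟨by linarith, by linarith⟩

lemma tvDist_nonneg (μ ν : Measure α) : 0 ≤ tvDist μ ν := Real.iSup_nonneg fun _ => abs_nonneg _

lemma real_le_add_tvDist (μ ν : Measure α) [IsProbabilityMeasure μ] [IsProbabilityMeasure ν]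
    {B : Set α} (hB : MeasurableSet B) : μ.real B ≤ ν.real B + tvDist μ ν := by
  have := le_ciSup (bddAbove_tvDist μ ν) ⟨B, hB⟩
  have h2 := (le_abs_self _).trans this
  unfold tvDist
  linarith

lemma tvDist_le_of_real_le_add {μ ν : Measure α} [IsProbabilityMeasure μ] [IsProbabilityMeasure ν]
    {e : ℝ} (h : ∀ B, MeasurableSet B → μ.real B ≤ ν.real B + e) : tvDist μ ν ≤ e := by
  refine Real.iSup_le (fun B => abs_le.2 ⟨?_, ?_⟩) ?_
  -- A one-sided bound on all events suffices: applied to complements it gives the other side.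
  · have := h B.1ᶜ B.2.compl
    rw [probReal_compl_eq_one_sub B.2, probReal_compl_eq_one_sub B.2] at this
    linarith
  · linarith [h B.1 B.2]
  · simpa using h Set.univ MeasurableSet.univ

lemma dExch_le_tvDist (μ : Measure (ι → α)) {ν : Measure (ι → α)} (h1 : IsProbabilityMeasure ν)
    (h2 : IsExchangeable ν) : dExch μ ≤ tvDist μ ν :=
  ciInf_le (f := fun ν : {ν : Measure (ι → α) // IsProbabilityMeasure ν ∧ IsExchangeable ν} =>
    tvDist μ ν.1) ⟨0, by rintro _ ⟨ν, rfl⟩; exact tvDist_nonneg _ _⟩ ⟨ν, h1, h2⟩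

end Exchangeability

/-! ### Rank p-values -/

section PValue

variable {α : Type*} {M : ℕ}

open Classical in
/-- The number of entries of `v` whose score is at least that of the `i`-th entry. -/
def upperRank (T : α → ℝ) (v : Fin (M + 1) → α) (i : Fin (M + 1)) : ℕ :=
  (Finset.univ.filter fun j => T (v i) ≤ T (v j)).card

lemma pval_eq_upperRank (T : α → ℝ) (x : α) (xt : Fin M → α) :
    pval T x xt = upperRank T (Fin.cons x xt : Fin (M + 1) → α) 0 / ((M : ℝ) + 1) := by
  classical
  rw [upperRank, Finset.card_filter, Fin.sum_univ_succ, pval]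
  simp
  ring

lemma upperRank_comp_perm (T : α → ℝ) (v : Fin (M + 1) → α) (π : Equiv.Perm (Fin (M + 1)))
    (i : Fin (M + 1)) : upperRank T (fun j => v (π j)) i = upperRank T v (π i) := by
  classical
  unfold upperRank
  refine Finset.card_bij (fun j _ => π j) (fun j hj => by simpa using hj)
    (fun a _ b _ h => π.injective h) fun j hj => ⟨π.symm j, by simpa using hj, by simp⟩

open Classical in
lemma card_upperRank_le (T : α → ℝ) (v : Fin (M + 1) → α) {t : ℝ} (ht : 0 ≤ t) :
    ((Finset.univ.filter fun i => (upperRank T v i : ℝ) ≤ t).card : ℝ) ≤ t := by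
  set I := Finset.univ.filter fun i => (upperRank T v i : ℝ) ≤ t with hI
  rcases I.eq_empty_or_nonempty with h | h
  · simpa [h] using ht
  -- The member of `I` with the smallest score has all of `I` at or above it, so the cardinality of
  -- `I` is at most its upper rank, ties included.
  · obtain ⟨i, hi, hmin⟩ := I.exists_min_image (fun i => T (v i)) h
    have h1 : I.card ≤ upperRank T v i := by
      unfold upperRank
      exact Finset.card_le_card fun j hj => by simpa using hmin j hj
    have h2 : (upperRank T v i : ℝ) ≤ t := by simpa [hI] using hi
    exact (Nat.cast_le.2 h1).trans h2

lemma setOf_pval_le_eq (T : α → ℝ) (a : ℝ) {Ω : Type*} (X : Ω → α) (Xt : Fin M → Ω → α) :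
    {ω | pval T (X ω) (fun m => Xt m ω) ≤ a} =
      (fun ω => (Fin.cons (X ω) (fun m => Xt m ω) : Fin (M + 1) → α)) ⁻¹'
        {v | (upperRank T v 0 : ℝ) ≤ a * (M + 1)} := by
  ext ω
  have hM : (0 : ℝ) < M + 1 := by positivity
  simp only [Set.mem_ofPred_eq, Set.mem_preimage]
  rw [pval_eq_upperRank, div_le_iff₀ hM]

variable [MeasurableSpace α]

lemma measurableSet_upperRank_le {T : α → ℝ} (hT : Measurable T) (t : ℝ) (i : Fin (M + 1)) :
    MeasurableSet {v : Fin (M + 1) → α | (upperRank T v i : ℝ) ≤ t} := by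
  classical
  have : Measurable fun v : Fin (M + 1) → α => (upperRank T v i : ℝ) := by
    have e : (fun v : Fin (M + 1) → α => (upperRank T v i : ℝ)) =
        fun v => ∑ j, if T (v i) ≤ T (v j) then (1 : ℝ) else 0 := by
      ext v
      simp [upperRank]
    rw [e]
    refine Finset.measurable_sum _ fun j _ => Measurable.ite ?_ measurable_const measurable_const
    exact measurableSet_le (hT.comp (measurable_pi_apply i)) (hT.comp (measurable_pi_apply j))
  exact measurableSet_le this measurable_const

/-- Rank p-values are superuniform under exchangeability. -/
lemma IsExchangeable.real_upperRank_le {ν : Measure (Fin (M + 1) → α)} [IsProbabilityMeasure ν]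
    (hν : IsExchangeable ν) {T : α → ℝ} (hT : Measurable T) {a : ℝ} (ha : 0 ≤ a) :
    ν.real {v | (upperRank T v 0 : ℝ) ≤ a * (M + 1)} ≤ a := by
  classical
  set t := a * ((M : ℝ) + 1) with ht
  have ht0 : 0 ≤ t := by positivity
  have hmeas := fun i => measurableSet_upperRank_le (M := M) hT t i
  -- Exchangeability makes the `M + 1` events equally likely, while the deterministic count bounds
  -- the sum of their probabilities by `a * (M + 1)`.
  have hsame : ∀ i, ν.real {v | (upperRank T v i : ℝ) ≤ t} =
      ν.real {v | (upperRank T v 0 : ℝ) ≤ t} := by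
    intro i
    conv_rhs => rw [← hν (Equiv.swap 0 i)]
    rw [map_measureReal_apply (by fun_prop) (hmeas 0)]
    congr 1
    ext v
    simp [upperRank_comp_perm]
  have hsum : ∑ i : Fin (M + 1), ν.real {v | (upperRank T v i : ℝ) ≤ t} ≤ t := by
    have h1 : ∀ i, ν.real {v | (upperRank T v i : ℝ) ≤ t} =
        ∫ v, Set.indicator {v | (upperRank T v i : ℝ) ≤ t} (fun _ => (1 : ℝ)) v ∂ν := by
      intro i
      rw [integral_indicator (hmeas i)]
      simp [Measure.real]
    have h2 : ∀ i, Integrable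
        (Set.indicator {v | (upperRank T v i : ℝ) ≤ t} (fun _ => (1 : ℝ))) ν :=
      fun i => (integrable_const _).indicator (hmeas i)
    simp_rw [h1]
    rw [← integral_finsetSum _ fun i _ => h2 i]
    calc _ ≤ ∫ _, t ∂ν := by
          refine integral_mono (integrable_finsetSum _ fun i _ => h2 i) (integrable_const _)
            fun v => ?_
          have := card_upperRank_le T v ht0
          rw [Finset.card_filter] at this
          push_cast at this
          simpa [Set.indicator_apply] using this
      _ = t := by simp
  simp_rw [hsame] at hsum
  rw [Finset.sum_const, Finset.card_univ, Fintype.card_fin, nsmul_eq_mul, ht] at hsum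
  push_cast at hsum
  have hM : (0 : ℝ) < M + 1 := by positivity
  nlinarith

end PValue

/-! ### Joint laws of data and copies -/

section Laws

variable {𝓧 𝓔 : Type*} [MeasurableSpace 𝓧] [MeasurableSpace 𝓔] {M : ℕ}

@[fun_prop]
lemma measurable_finCons {β : Type*} [MeasurableSpace β] {f : β → 𝓧} {g : β → Fin M → 𝓧}
    (hf : Measurable f) (hg : Measurable g) :
    Measurable fun y => (Fin.cons (f y) (g y) : Fin (M + 1) → 𝓧) := by
  refine measurable_pi_iff.2 fun i => ?_
  refine Fin.cases ?_ (fun j => ?_) i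
  · simpa using hf
  · simp only [Fin.cons_succ]
    exact (measurable_pi_apply j).comp hg

/-- Joint law of the data and the copies, when the data and a covariate have law `Q` and the copies
are drawn from `K`. -/
def consLaw (Q : Measure (𝓧 × 𝓔)) (K : Kernel (𝓧 × 𝓔) (Fin M → 𝓧)) : Measure (Fin (M + 1) → 𝓧) :=
  (Q ⊗ₘ K).map fun y => Fin.cons y.1.1 y.2

instance (Q : Measure (𝓧 × 𝓔)) (K : Kernel (𝓧 × 𝓔) (Fin M → 𝓧)) [IsProbabilityMeasure Q]
    [IsMarkovKernel K] : IsProbabilityMeasure (consLaw Q K) :=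
  Measure.isProbabilityMeasure_map (by fun_prop)

/-- The probability that the data and the copies drawn from `K` lie in `B`, given the data. -/
def consProb (K : Kernel (𝓧 × 𝓔) (Fin M → 𝓧)) (B : Set (Fin (M + 1) → 𝓧)) (y : 𝓧 × 𝓔) : ℝ≥0∞ :=
  K y {v | (Fin.cons y.1 v : Fin (M + 1) → 𝓧) ∈ B}

lemma measurable_consProb (K : Kernel (𝓧 × 𝓔) (Fin M → 𝓧)) [IsSFiniteKernel K]
    {B : Set (Fin (M + 1) → 𝓧)} (hB : MeasurableSet B) : Measurable (consProb K B) :=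
  Kernel.measurable_kernel_prodMk_left (κ := K)
    (t := {y : (𝓧 × 𝓔) × (Fin M → 𝓧) | (Fin.cons y.1.1 y.2 : Fin (M + 1) → 𝓧) ∈ B})
    ((by fun_prop : Measurable fun y : (𝓧 × 𝓔) × (Fin M → 𝓧) =>
      (Fin.cons y.1.1 y.2 : Fin (M + 1) → 𝓧)) hB)

lemma consLaw_apply (Q : Measure (𝓧 × 𝓔)) [SFinite Q] (K : Kernel (𝓧 × 𝓔) (Fin M → 𝓧))
    [IsSFiniteKernel K] {B : Set (Fin (M + 1) → 𝓧)} (hB : MeasurableSet B) :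
    consLaw Q K B = ∫⁻ y, consProb K B y ∂Q := by
  have hm : Measurable fun y : (𝓧 × 𝓔) × (Fin M → 𝓧) => (Fin.cons y.1.1 y.2 : Fin (M + 1) → 𝓧) := by
    fun_prop
  rw [consLaw, Measure.map_apply hm hB, Measure.compProd_apply (hm hB)]
  rfl

/-- The run fixes probabilities only on rectangles, and these determine the joint law of data,
perturbation and copies. -/
lemma Problem.IsRun.map_eq_consLaw {d k : ℕ} {p : Problem 𝓧 d k}
    {κ : Kernel (𝓧 × EuclideanSpace ℝ (Fin d) × EuclideanSpace ℝ (Fin d)) (Fin M → 𝓧)}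
    {PX : Measure 𝓧} [IsProbabilityMeasure PX] {Ω : Type*} [MeasurableSpace Ω] {P : Measure Ω}
    [IsProbabilityMeasure P]
    {X : Ω → 𝓧} {W : Ω → EuclideanSpace ℝ (Fin d)} {Xt : Fin M → Ω → 𝓧}
    (h : p.IsRun κ PX P X W Xt) (K : Kernel (𝓧 × EuclideanSpace ℝ (Fin d)) (Fin M → 𝓧))
    [IsMarkovKernel K] (hK : ∀ x w, p.copiesLaw κ x w = K (x, w)) :
    P.map (fun ω => (Fin.cons (X ω) (fun m => Xt m ω) : Fin (M + 1) → 𝓧)) =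
      consLaw (PX.prod (multivariateGaussian 0 ((1 / (d : ℝ)) • (1 : Matrix (Fin d) (Fin d) ℝ))))
        K := by
  have h1 : AEMeasurable (fun ω => (X ω, W ω)) P := h.law_data.aemeasurable
  have h2 : AEMeasurable (fun ω m => Xt m ω) P := aemeasurable_pi_iff.2 h.aemeasurable_copies
  have h3 := h1.prodMk h2
  have key : P.map (fun ω => ((X ω, W ω), fun m => Xt m ω)) =
      (PX.prod (multivariateGaussian 0 ((1 / (d : ℝ)) • (1 : Matrix (Fin d) (Fin d) ℝ)))) ⊗ₘ K := by
    have : IsProbabilityMeasure (P.map fun ω => ((X ω, W ω), fun m => Xt m ω)) :=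
      Measure.isProbabilityMeasure_map h3
    refine Measure.ext_prod fun {S B} hS hB => ?_
    rw [Measure.map_apply_of_aemeasurable h3 (hS.prod hB), Measure.compProd_apply_prod hS hB]
    have h4 := h.law_copies S B hS hB
    have h5 : (fun ω => ((X ω, W ω), fun m => Xt m ω)) ⁻¹' S ×ˢ B =
      {ω | (X ω, W ω) ∈ S ∧ (fun m => Xt m ω) ∈ B} := rfl
    rw [h5, h4, ← h.law_data.map_eq, Measure.restrict_map_of_aemeasurable h1 hS,
      lintegral_map' (K.measurable_coe hB).aemeasurable h1.restrict]
    simp_rw [hK]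
    rfl
  rw [consLaw, ← key, AEMeasurable.map_map_of_aemeasurable (by fun_prop) h3]
  rfl

end Laws

/-! ### The plug-in law as a conditional law -/

section PlugIn

lemma inv_lintegral_smul_withDensity_const_mul {α : Type*} [MeasurableSpace α] {μ : Measure α}
    {f p : α → ℝ} {c : ℝ} (hc : 0 < c) (hp : Measurable p)
    (h1 : ∫⁻ x, ENNReal.ofReal (p x) ∂μ = 1) (hf : ∀ x, f x = c * p x) :
    (∫⁻ x, ENNReal.ofReal (f x) ∂μ)⁻¹ • μ.withDensity (fun x => ENNReal.ofReal (f x)) =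
      μ.withDensity fun x => ENNReal.ofReal (p x) := by
  have e : ∀ x, ENNReal.ofReal (f x) = ENNReal.ofReal c * ENNReal.ofReal (p x) := fun x => by
    rw [hf, ENNReal.ofReal_mul hc.le]
  have hpm : Measurable fun x => ENNReal.ofReal (p x) := by fun_prop
  have hc0 : ENNReal.ofReal c ≠ 0 := by simpa using hc
  simp_rw [e]
  rw [lintegral_const_mul _ hpm, h1, mul_one]
  have : (fun x => ENNReal.ofReal c * ENNReal.ofReal (p x)) =
    ENNReal.ofReal c • fun x => ENNReal.ofReal (p x) := rfl
  rw [this, withDensity_smul _ hpm, smul_smul, ENNReal.inv_mul_cancel hc0 ENNReal.ofReal_ne_top,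
    one_smul]

lemma map_add_right_expLaw {ι : Type*} [Fintype ι] {q : EuclideanSpace ℝ ι → ℝ} (hq : Measurable q)
    (m : EuclideanSpace ℝ ι) :
    (expLaw q).map (fun z => z + m) = volume.withDensity fun x =>
      ENNReal.ofReal ((∫ y, Real.exp (-(q y / 2)))⁻¹ * Real.exp (-(q (x - m) / 2))) := by
  refine Measure.ext_of_lintegral _ fun f hf => ?_
  rw [lintegral_map hf (by fun_prop), lintegral_expLaw_translate hq hf,
    lintegral_withDensity_eq_lintegral_mul _ (by fun_prop) hf]
  rfl

variable {n d k : ℕ} (Z : Matrix (Fin n) (Fin d) ℝ) {ν : ℝ}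
  {R : EuclideanSpace ℝ (Fin d) → ℝ} (A : Matrix (Fin k) (Fin d) ℝ) (b : Fin k → ℝ) {σ c : ℝ}

/-- For each `x`, the perturbation `w = σ⁻¹ (u + ν⁻² Zᵀ x)` produces the score `u`, hence the same
estimator and gradient. This removes the indicator from the plug-in density. -/
lemma compatible_eq_univ (hν : 0 < ν) (hσ : 0 < σ) (hR : Differentiable ℝ R)
    (hR' : Differentiable ℝ (gradient R))
    (hc : 0 < c) (hRc : ∀ θ : EuclideanSpace ℝ (Fin d),
      ((1 / ν ^ 2) • (Zᵀ * Z) + hessian R θ - c • (1 : Matrix (Fin d) (Fin d) ℝ)).PosDef)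
    (hne : {θ | ∀ i, inner ℝ (row A i) θ ≤ b i}.Nonempty) (u : EuclideanSpace ℝ (Fin d)) :
    (gaussianProblem Z ν R A b σ).compatible (scoreArgmin Z A b ν R u) (scoreGrad Z A b ν R u) =
      Set.univ := by
  refine Set.eq_univ_of_forall fun x => ⟨σ⁻¹ • (u + scaledAdjoint (designMap Z) ν x), ?_⟩
  have hu : score (designMap Z) ν σ (x, σ⁻¹ • (u + scaledAdjoint (designMap Z) ν x)) = u := by
    simp [score, smul_smul, mul_inv_cancel₀ hσ.ne']
  have h1 := thetaHat_eq (R := R) Z A b σ hν x (σ⁻¹ • (u + scaledAdjoint (designMap Z) ν x))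
  rw [hu] at h1
  refine ⟨h1.symm, ?_, ?_⟩
  · rw [← h1]; exact isSSOSP_thetaHat Z A b σ hν hR hR' hc hRc hne _ _
  · rw [gradient_loss Z A b σ hν hR, hu, scoreGrad]

/-- The plug-in law is the conditional law of the data given the perturbed score at the
estimated parameter. -/
lemma plugInLaw_eq (hd : 0 < d) (hν : 0 < ν) (hσ : 0 < σ) (hR : Differentiable ℝ R)
    (hR' : Differentiable ℝ (gradient R))
    (hc : 0 < c) (hRc : ∀ θ : EuclideanSpace ℝ (Fin d),
      ((1 / ν ^ 2) • (Zᵀ * Z) + hessian R θ - c • (1 : Matrix (Fin d) (Fin d) ℝ)).PosDef)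
    (hne : {θ | ∀ i, inner ℝ (row A i) θ ≤ b i}.Nonempty) (u : EuclideanSpace ℝ (Fin d)) :
    (gaussianProblem Z ν R A b σ).plugInLaw (scoreArgmin Z A b ν R u) (scoreGrad Z A b ν R u) =
      (expLaw (precision (designMap Z) ν (σ ^ 2 * (1 / (d : ℝ))))).map fun z =>
        z + condMean (designMap Z) ν (σ ^ 2 * (1 / (d : ℝ))) (scoreArgmin Z A b ν R u) u := by
  have hd' : (0 : ℝ) < d := by exact_mod_cast hd
  set s := σ ^ 2 * (1 / (d : ℝ)) with hs
  have hs0 : 0 < s := by positivity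
  set θ := scoreArgmin Z A b ν R u with hθ
  have hqm := (continuous_precision (designMap Z) (ν := ν) (s := s)).measurable
  have hprob := isProbabilityMeasure_expLaw (integrable_exp_precision (designMap Z) hν hs0)
  obtain ⟨g, -, hg0, hg⟩ :=
    exists_isoDensity_mul_isoDensity_eq (designMap Z) (ν := ν) (σ := σ) (τ := 1 / (d : ℝ)) hν hs0 θ
  have hdet : 0 < ((orthoBasis A ((gaussianProblem Z ν R A b σ).activeSet θ))ᵀ *
      potentialHessian Z ν R θ *
      orthoBasis A ((gaussianProblem Z ν R A b σ).activeSet θ)).det :=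
    (posDef_orthoBasis_conj _ _ (posDef_potentialHessian Z hc (hRc θ))).det_pos
  set D := ((orthoBasis A ((gaussianProblem Z ν R A b σ).activeSet θ))ᵀ *
      potentialHessian Z ν R θ *
      orthoBasis A ((gaussianProblem Z ν R A b σ).activeSet θ)).det
  set C : ℝ := (2 * Real.pi * s) ^ ((Fintype.card (Fin d) : ℝ) / 2) with hC
  have hC0 : 0 < C := by positivity
  have hmap := map_add_right_expLaw hqm (condMean (designMap Z) ν s θ u)
  have hplug : ∀ x, (gaussianProblem Z ν R A b σ).plugInDensity θ (scoreGrad Z A b ν R u) x =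
      (C * g u * D) * ((∫ y, Real.exp (-(precision (designMap Z) ν s y / 2)))⁻¹ *
          Real.exp (-(precision (designMap Z) ν s
            (x - condMean (designMap Z) ν s θ u) / 2))) := by
    intro x
    rw [Problem.plugInDensity, compatible_eq_univ Z A b hν hσ hR hR' hc hRc hne,
      Set.indicator_univ, gradient_loss₀ Z A b σ hν hR,
      hessian_eq_of_gradient_eq Z hR' (gradient_loss₀ Z A b σ hν hR x), scoreGrad, ← hθ]
    have e1 : (gaussianProblem Z ν R A b σ).f θ x = isoDensity (ν ^ 2) (designMap Z θ) x := by
      simp [gaussianProblem, gaussianDensity, isoDensity, designMap_apply]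
    -- The potential gradients cancel, leaving `u + ν⁻² Zᵀ x`: the exponential weight is the
    -- conditional density of the score given `x`, up to the constant `C`.
    have e2 : Real.exp (-(‖potentialGrad Z ν R θ + u -
        (potentialGrad Z ν R θ + -scaledAdjoint (designMap Z) ν x)‖ ^ 2 /
          (2 * (gaussianProblem Z ν R A b σ).σ ^ 2 / (d : ℝ)))) =
        C * isoDensity s (-scaledAdjoint (designMap Z) ν x) u := by
      rw [isoDensity, ← hC, ← mul_assoc, mul_one_div_cancel hC0.ne', one_mul,
        add_sub_add_left_eq_sub]
      congr 4
      simp only [gaussianProblem, hs]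
      ring
    have hg' := hg u x
    rw [← hs] at hg'
    rw [e1, e2]
    change _ * D = _
    calc _ = C * D * (isoDensity (ν ^ 2) (designMap Z θ) x *
          isoDensity s (-scaledAdjoint (designMap Z) ν x) u) := by ring
      _ = _ := by rw [hg']; ring
  rw [hmap]
  refine inv_lintegral_smul_withDensity_const_mul (c := C * g u * D)
    (by have := hg0 u; positivity) (by fun_prop) ?_ hplug
  have hone : ((expLaw (precision (designMap Z) ν s)).map
      fun z => z + condMean (designMap Z) ν s θ u) Set.univ = 1 := by
    have := Measure.isProbabilityMeasure_map (μ := expLaw (precision (designMap Z) ν s))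
      (f := fun z => z + condMean (designMap Z) ν s θ u) (by fun_prop)
    exact measure_univ
  rw [hmap, withDensity_apply _ MeasurableSet.univ, setLIntegral_univ] at hone
  exact hone

end PlugIn

/-! ### Mixtures of exchangeable laws -/

section Mixture

variable {𝓧 𝓔 : Type*} [MeasurableSpace 𝓧] [MeasurableSpace 𝓔] {M : ℕ}

lemma plugInJointLaw_apply {d k : ℕ} (p : Problem 𝓧 d k)
    (κ : Kernel (𝓧 × EuclideanSpace ℝ (Fin d) × EuclideanSpace ℝ (Fin d)) (Fin M → 𝓧))
    [IsMarkovKernel κ] (θ g : EuclideanSpace ℝ (Fin d)) [SFinite (p.plugInLaw θ g)]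
    {B : Set (Fin (M + 1) → 𝓧)} (hB : MeasurableSet B) :
    p.plugInJointLaw κ θ g B =
      ∫⁻ x, κ (x, θ, g) {v | (Fin.cons x v : Fin (M + 1) → 𝓧) ∈ B} ∂(p.plugInLaw θ g) := by
  have hm : Measurable fun y : 𝓧 × (Fin M → 𝓧) => (Fin.cons y.1 y.2 : Fin (M + 1) → 𝓧) := by
    fun_prop
  rw [Problem.plugInJointLaw, Measure.map_apply hm hB, Measure.compProd_apply (hm hB)]
  rfl

lemma isExchangeable_of_lintegral {ι : Type*} {μ : Measure (ι → 𝓧)} (Q : Measure 𝓔)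
    (J : 𝓔 → Measure (ι → 𝓧)) (hJ : ∀ u, IsExchangeable (J u))
    (h : ∀ B, MeasurableSet B → μ B = ∫⁻ u, J u B ∂Q) : IsExchangeable μ := by
  intro π
  have hπ : Measurable fun (v : ι → 𝓧) i => v (π i) := by fun_prop
  ext B hB
  rw [Measure.map_apply hπ hB, h _ (hπ hB), h B hB]
  refine lintegral_congr fun u => ?_
  conv_rhs => rw [← hJ u π, Measure.map_apply hπ hB]

end Mixture

/-! ### Comparison with the exchangeable law -/

section Main

variable {n d k M : ℕ}

lemma measurable_condMean_comp {ι κ : Type*} [Fintype ι] [Fintype κ]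
    (L : EuclideanSpace ℝ ι →L[ℝ] EuclideanSpace ℝ κ) {ν s : ℝ}
    {t : EuclideanSpace ℝ ι → EuclideanSpace ℝ ι} (ht : Measurable t) :
    Measurable fun u => condMean L ν s (t u) u := by
  have h1 := (continuous_condMean L (ν := ν) (s := s)).measurable
  exact h1.comp (ht.prodMk measurable_id)

lemma lintegral_expLaw_add_le {ι κ : Type*} [Fintype ι] [Fintype κ]
    (L : EuclideanSpace ℝ ι →L[ℝ] EuclideanSpace ℝ κ) {ν s : ℝ} (hν : 0 < ν) (hs : 0 < s)
    (θ θ' u : EuclideanSpace ℝ ι) {h : EuclideanSpace ℝ κ → ℝ≥0∞} (hh : Measurable h)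
    (h1 : ∀ x, h x ≤ 1) :
    ∫⁻ z, h (z + condMean L ν s θ u) ∂(expLaw (precision L ν s)) ≤
      ∫⁻ z, h (z + condMean L ν s θ' u) ∂(expLaw (precision L ν s)) +
        ENNReal.ofReal (√s / 2 * ‖θ - θ'‖) := by
  have key := lintegral_add_right_expLaw_le (q := precision L ν s) (continuous_precision L).measurable
    (precision_parallelogram L) (precision_nonneg L hs) (integrable_exp_precision L hν hs)
    (condMean L ν s θ u - condMean L ν s θ' u) (h := fun z => h (z + condMean L ν s θ' u))
    (by fun_prop) fun _ => h1 _
  simp only [add_assoc, sub_add_cancel] at key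
  refine key.trans (add_le_add le_rfl (ENNReal.ofReal_le_ofReal ?_))
  have h2 := Real.sqrt_le_sqrt (precision_condMean_sub_le L (ν := ν) hs θ θ' u)
  rw [Real.sqrt_mul hs.le, Real.sqrt_sq (norm_nonneg _)] at h2
  linarith

/-- Averaging a bound that holds on `S` and the trivial bound off `S`. -/
lemma lintegral_le_add_ofReal {𝓔 : Type*} [MeasurableSpace 𝓔] (Q : Measure 𝓔)
    [IsProbabilityMeasure Q] {S : Set 𝓔} (hS : MeasurableSet S) {δ e : ℝ} (he : 0 ≤ e)
    (hQ : 1 - δ ≤ Q.real S) {f g : 𝓔 → ℝ≥0∞} (hg : Measurable g)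
    (h1 : ∀ u ∈ S, f u ≤ g u + ENNReal.ofReal e) (h2 : ∀ u, f u ≤ 1) :
    ∫⁻ u, f u ∂Q ≤ ∫⁻ u, g u ∂Q + ENNReal.ofReal (e + δ) := by
  have hδ : Q.real Sᶜ ≤ δ := by rw [probReal_compl_eq_one_sub hS]; linarith
  have hδ0 : 0 ≤ δ := measureReal_nonneg.trans hδ
  calc ∫⁻ u, f u ∂Q ≤ ∫⁻ u, (g u + (ENNReal.ofReal e + Sᶜ.indicator 1 u)) ∂Q := by
        refine lintegral_mono fun u => ?_
        by_cases hu : u ∈ S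
        · exact (h1 u hu).trans (by gcongr; exact le_self_add)
        · refine (h2 u).trans ?_
          rw [Set.indicator_of_mem (Set.mem_compl hu)]
          exact le_add_left (le_add_left le_rfl)
    _ = ∫⁻ u, g u ∂Q + (ENNReal.ofReal e + Q Sᶜ) := by
        rw [lintegral_add_left hg, lintegral_add_left measurable_const, lintegral_const,
          measure_univ, mul_one, lintegral_indicator_one hS.compl]
    _ ≤ _ := by
        rw [ENNReal.ofReal_add he hδ0, ← ofReal_measureReal (μ := Q) (s := Sᶜ)]
        gcongr

lemma real_setOf_pval_le {α Ω : Type*} [MeasurableSpace α] [MeasurableSpace Ω] {P : Measure Ω}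
    [IsProbabilityMeasure P] {X : Ω → α} {Xt : Fin M → Ω → α}
    (hm : AEMeasurable (fun ω => (Fin.cons (X ω) (fun m => Xt m ω) : Fin (M + 1) → α)) P)
    {ν : Measure (Fin (M + 1) → α)} [IsProbabilityMeasure ν] (hν : IsExchangeable ν)
    {T : α → ℝ} (hT : Measurable T) {a : ℝ} (ha : 0 ≤ a) :
    P.real {ω | pval T (X ω) (fun m => Xt m ω) ≤ a} ≤
      a + tvDist (P.map fun ω => (Fin.cons (X ω) (fun m => Xt m ω) : Fin (M + 1) → α)) ν := by
  have := Measure.isProbabilityMeasure_map hm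
  have hB := measurableSet_upperRank_le (M := M) hT (a * (M + 1)) 0
  have h1 := real_le_add_tvDist
    (P.map fun ω => (Fin.cons (X ω) (fun m => Xt m ω) : Fin (M + 1) → α)) ν hB
  rw [Measure.real, Measure.map_apply_of_aemeasurable hm hB, ← setOf_pval_le_eq] at h1
  exact h1.trans (add_le_add_left (hν.real_upperRank_le hT ha) _)

/-- The joint law of a run is within the stated distance of an exchangeable law. -/
lemma exists_isExchangeable_tvDist_le (hd : 0 < d)
    (Z : Matrix (Fin n) (Fin d) ℝ) {ν σ : ℝ} (hν : 0 < ν) (hσ : 0 < σ)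
    {R : EuclideanSpace ℝ (Fin d) → ℝ}
    (hR : Differentiable ℝ R) (hR' : Differentiable ℝ (gradient R)) {c : ℝ} (hc : 0 < c)
    (hRc : ∀ θ : EuclideanSpace ℝ (Fin d),
      ((1 / ν ^ 2) • (Zᵀ * Z) + hessian R θ - c • (1 : Matrix (Fin d) (Fin d) ℝ)).PosDef)
    (A : Matrix (Fin k) (Fin d) ℝ) (b : Fin k → ℝ)
    (hne : {θ | ∀ i, inner ℝ (row A i) θ ≤ b i}.Nonempty)
    (κ : Kernel (EuclideanSpace ℝ (Fin n) × EuclideanSpace ℝ (Fin d) × EuclideanSpace ℝ (Fin d))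
      (Fin M → EuclideanSpace ℝ (Fin n)))
    [IsMarkovKernel κ]
    (hκ : (gaussianProblem Z ν R A b σ).IsExchangeableSampler κ)
    (θ₀ : EuclideanSpace ℝ (Fin d)) {r δ : ℝ} (hr : 0 ≤ r)
    {Ω : Type*} [MeasurableSpace Ω] (P : Measure Ω) [IsProbabilityMeasure P]
    {X : Ω → EuclideanSpace ℝ (Fin n)} {W : Ω → EuclideanSpace ℝ (Fin d)}
    {Xt : Fin M → Ω → EuclideanSpace ℝ (Fin n)}
    (hrun : (gaussianProblem Z ν R A b σ).IsRun κ (gaussianLaw Z ν θ₀) P X W Xt)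
    (hacc : 1 - δ ≤ P.real {ω | ‖(gaussianProblem Z ν R A b σ).thetaHat (X ω) (W ω) - θ₀‖ ≤ r}) :
    ∃ μ' : Measure (Fin (M + 1) → EuclideanSpace ℝ (Fin n)), IsProbabilityMeasure μ' ∧
      IsExchangeable μ' ∧
      tvDist (P.map fun ω => (Fin.cons (X ω) (fun m => Xt m ω) :
        Fin (M + 1) → EuclideanSpace ℝ (Fin n))) μ' ≤ σ / (2 * √(d : ℝ)) * r + δ := by
  have hd' : (0 : ℝ) < d := by exact_mod_cast hd
  set τ : ℝ := 1 / (d : ℝ) with hτ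
  have hτ0 : 0 < τ := by positivity
  set s := σ ^ 2 * τ with hs
  have hs0 : 0 < s := by positivity
  have hconv := isStronglyConvexWith_potential Z hν hR hR' hc hRc
  have hθm := (continuous_scoreArgmin Z A b hconv hne).measurable
  have hgm := (continuous_scoreGrad Z A b hconv hne).measurable
  have hsm := (continuous_score (designMap Z) (ν := ν) (σ := σ)).measurable
  set t := scoreArgmin Z A b ν R with ht
  set q := precision (designMap Z) ν s with hq
  have hρ := isProbabilityMeasure_expLaw (integrable_exp_precision (designMap Z) hν hs0)
  rw [← hq] at hρ
  let PX : Measure (EuclideanSpace ℝ (Fin n)) := gaussianLaw Z ν θ₀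
  let γ : Measure (EuclideanSpace ℝ (Fin d)) :=
    multivariateGaussian 0 (τ • (1 : Matrix (Fin d) (Fin d) ℝ))
  have hPX : IsProbabilityMeasure PX := by
    change IsProbabilityMeasure (multivariateGaussian _ _); infer_instance
  let Q := (PX.prod γ).map (score (designMap Z) ν σ)
  have hQ : IsProbabilityMeasure Q := Measure.isProbabilityMeasure_map hsm.aemeasurable
  have hm' : Measurable fun u => condMean (designMap Z) ν s (t u) u :=
    measurable_condMean_comp _ hθm
  let K : Kernel (EuclideanSpace ℝ (Fin n) × EuclideanSpace ℝ (Fin d))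
      (Fin M → EuclideanSpace ℝ (Fin n)) :=
    κ.comap (fun y => (y.1, t y.2, scoreGrad Z A b ν R y.2)) (by fun_prop)
  let K₀ : Kernel (EuclideanSpace ℝ (Fin n) × EuclideanSpace ℝ (Fin d))
      (Fin M → EuclideanSpace ℝ (Fin n)) :=
    K.comap (fun y => (y.1, score (designMap Z) ν σ y)) (by fun_prop)
  have hcopies : ∀ x w, (gaussianProblem Z ν R A b σ).copiesLaw κ x w = K₀ (x, w) := by
    intro x w
    rw [Problem.copiesLaw, if_pos (isSSOSP_thetaHat Z A b σ hν hR hR' hc hRc hne x w),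
      thetaHat_eq Z A b σ hν, gHat_eq Z A b σ hν hR]
    rfl
  have hlaw := hrun.map_eq_consLaw K₀ hcopies
  let shift : EuclideanSpace ℝ (Fin d) × EuclideanSpace ℝ (Fin n) →
      EuclideanSpace ℝ (Fin n) × EuclideanSpace ℝ (Fin d) :=
    fun y => (y.2 + condMean (designMap Z) ν s (t y.1) y.1, y.1)
  have hshift : Measurable shift :=
    (measurable_snd.add (hm'.comp measurable_fst)).prodMk measurable_fst
  -- The comparison law of (data, score): same score marginal `Q`, but the conditional mean uses the
  -- estimator `t u` in place of `θ₀`.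
  let Q' := (Q.prod (expLaw q)).map shift
  have hQ' : IsProbabilityMeasure Q' := Measure.isProbabilityMeasure_map hshift.aemeasurable
  have hcons : ∀ B, MeasurableSet B → Measurable (consProb K B) :=
    fun B hB => measurable_consProb K hB
  have hinner : ∀ B, MeasurableSet B → Measurable fun u =>
      ∫⁻ z, consProb K B (z + condMean (designMap Z) ν s (t u) u, u) ∂(expLaw q) := fun B hB =>
    Measurable.lintegral_prod_right' (f := fun y : EuclideanSpace ℝ (Fin d) ×
      EuclideanSpace ℝ (Fin n) => consProb K B (shift y)) ((hcons B hB).comp hshift)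
  have hν' : ∀ B, MeasurableSet B → consLaw Q' K B =
      ∫⁻ u, ∫⁻ z, consProb K B (z + condMean (designMap Z) ν s (t u) u, u) ∂(expLaw q) ∂Q := by
    intro B hB
    rw [consLaw_apply _ _ hB, lintegral_map (hcons B hB) hshift,
      lintegral_prod (fun y => consProb K B (shift y)) ((hcons B hB).comp hshift).aemeasurable]
  have hμ : ∀ B, MeasurableSet B → consLaw (PX.prod γ) K₀ B =
      ∫⁻ u, ∫⁻ z, consProb K B (z + condMean (designMap Z) ν s θ₀ u, u) ∂(expLaw q) ∂Q := by
    intro B hB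
    rw [consLaw_apply _ _ hB]
    exact lintegral_score (designMap Z) hν hσ hτ0 θ₀ (hcons B hB)
  refine ⟨consLaw Q' K, inferInstance, ?_, ?_⟩
  · have hplug := fun u => plugInLaw_eq Z A b hd hν hσ hR hR' hc hRc hne u
    have hprob : ∀ u, IsProbabilityMeasure ((gaussianProblem Z ν R A b σ).plugInLaw (t u)
        (scoreGrad Z A b ν R u)) := fun u => by
      rw [hplug u]; exact Measure.isProbabilityMeasure_map (by fun_prop)
    refine isExchangeable_of_lintegral Q (fun u => (gaussianProblem Z ν R A b σ).plugInJointLaw κ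
      (t u) (scoreGrad Z A b ν R u)) (fun u => hκ _ _ (hprob u)) fun B hB => ?_
    rw [hν' B hB]
    refine lintegral_congr fun u => ?_
    have := hprob u
    rw [plugInJointLaw_apply _ _ _ _ hB, hplug u, lintegral_map _ (by fun_prop)]
    · rfl
    · exact (hcons B hB).comp (measurable_id.prodMk (measurable_const (a := u)))
  · have hμprob : IsProbabilityMeasure (P.map fun ω => (Fin.cons (X ω) (fun m => Xt m ω) :
        Fin (M + 1) → EuclideanSpace ℝ (Fin n))) := by
      rw [hlaw]; infer_instance
    refine tvDist_le_of_real_le_add fun B hB => ?_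
    have hS : MeasurableSet {u | ‖t u - θ₀‖ ≤ r} := measurableSet_le (by fun_prop) measurable_const
    -- The accuracy event is an event about the score alone, so it can be used after conditioning on
    -- `u`.
    have hQS : 1 - δ ≤ Q.real {u | ‖t u - θ₀‖ ≤ r} := by
      refine hacc.trans (le_of_eq ?_)
      rw [map_measureReal_apply hsm hS, ← hrun.law_data.map_eq, Measure.real, Measure.real,
        Measure.map_apply_of_aemeasurable hrun.law_data.aemeasurable (hsm hS)]
      congr 2
      ext ω
      simp only [thetaHat_eq Z A b σ hν]
      rfl
    have hτr : √s / 2 = σ / (2 * √(d : ℝ)) := by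
      rw [hs, hτ, Real.sqrt_mul (by positivity), Real.sqrt_sq hσ.le, Real.sqrt_div zero_le_one,
        Real.sqrt_one]
      field_simp
    have hle1 : ∀ y, consProb K B y ≤ 1 := fun y => prob_le_one
    have hbound : consLaw (PX.prod γ) K₀ B ≤
        consLaw Q' K B + ENNReal.ofReal (σ / (2 * √(d : ℝ)) * r + δ) := by
      rw [hμ B hB, hν' B hB]
      refine lintegral_le_add_ofReal Q hS (by positivity) hQS (hinner B hB) (fun u hu => ?_)
        fun u => ?_
      · have h1 := lintegral_expLaw_add_le (designMap Z) hν hs0 θ₀ (t u) u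
          (h := fun x => consProb K B (x, u)) ((hcons B hB).comp (by fun_prop)) fun _ => hle1 _
        refine h1.trans (add_le_add le_rfl (ENNReal.ofReal_le_ofReal ?_))
        rw [hτr, norm_sub_rev]
        have hu' : ‖t u - θ₀‖ ≤ r := hu
        gcongr
      · calc _ ≤ ∫⁻ _, 1 ∂(expLaw q) := lintegral_mono fun z => hle1 _
          _ = 1 := by simp
    have hδ0 : 0 ≤ δ := by linarith [measureReal_le_one (μ := Q) (s := {u | ‖t u - θ₀‖ ≤ r})]
    rw [hlaw]
    have := ENNReal.toReal_mono (by finiteness) hbound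
    rw [ENNReal.toReal_add (by finiteness) (by finiteness),
      ENNReal.toReal_ofReal (by positivity)] at this
    exact this

end Main

end ACSS

end

theorem theorem3 {n d k M : ℕ} (hd : 0 < d)
    (Z : Matrix (Fin n) (Fin d) ℝ) (ν σ : ℝ) (hν : 0 < ν) (hσ : 0 < σ)
    (R : EuclideanSpace ℝ (Fin d) → ℝ)
    (hR : Differentiable ℝ R) (hR' : Differentiable ℝ (gradient R))
    (hRc : ∃ c : ℝ, 0 < c ∧ ∀ θ : EuclideanSpace ℝ (Fin d),
      ((1 / ν ^ 2) • (Zᵀ * Z) + ACSS.hessian R θ - c • (1 : Matrix (Fin d) (Fin d) ℝ)).PosDef)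
    (A : Matrix (Fin k) (Fin d) ℝ) (b : Fin k → ℝ)
    (hfeas : (ACSS.gaussianProblem Z ν R A b σ).feasible.Nonempty)
    (κ : Kernel (EuclideanSpace ℝ (Fin n) × EuclideanSpace ℝ (Fin d) × EuclideanSpace ℝ (Fin d))
      (Fin M → EuclideanSpace ℝ (Fin n)))
    [IsMarkovKernel κ]
    (hκ : (ACSS.gaussianProblem Z ν R A b σ).IsExchangeableSampler κ)
    (θ₀ : EuclideanSpace ℝ (Fin d)) (r δ : ℝ) (hr : 0 ≤ r)
    {Ω : Type*} [MeasurableSpace Ω] (P : Measure Ω) [IsProbabilityMeasure P]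
    (X : Ω → EuclideanSpace ℝ (Fin n)) (W : Ω → EuclideanSpace ℝ (Fin d))
    (Xt : Fin M → Ω → EuclideanSpace ℝ (Fin n))
    (hrun : (ACSS.gaussianProblem Z ν R A b σ).IsRun κ (ACSS.gaussianLaw Z ν θ₀) P X W Xt)
    (hacc : 1 - δ ≤
      P.real {ω | ‖(ACSS.gaussianProblem Z ν R A b σ).thetaHat (X ω) (W ω) - θ₀‖ ≤ r}) :
    ACSS.dExch (P.map (fun ω => (Fin.cons (X ω) (fun m => Xt m ω) :
        Fin (M + 1) → EuclideanSpace ℝ (Fin n)))) ≤ σ / (2 * √(d : ℝ)) * r + δ ∧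
    ∀ T : EuclideanSpace ℝ (Fin n) → ℝ, Measurable T → ∀ α : ℝ, 0 ≤ α → α ≤ 1 →
      P.real {ω | ACSS.pval T (X ω) (fun m => Xt m ω) ≤ α} ≤
        α + σ / (2 * √(d : ℝ)) * r + δ := by
  obtain ⟨c, hc, hRc⟩ := hRc
  rw [ACSS.feasible_eq] at hfeas
  obtain ⟨μ', h1, h2, h3⟩ := ACSS.exists_isExchangeable_tvDist_le hd Z hν hσ hR hR' hc hRc A b
    hfeas κ hκ θ₀ hr P hrun hacc
  have hm : AEMeasurable (fun ω => (Fin.cons (X ω) (fun m => Xt m ω) :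
      Fin (M + 1) → EuclideanSpace ℝ (Fin n))) P := by
    have hX := measurable_fst.comp_aemeasurable hrun.law_data.aemeasurable
    refine aemeasurable_pi_iff.2 fun i => Fin.cases ?_ (fun j => ?_) i
    · exact hX
    · exact hrun.aemeasurable_copies j
  refine ⟨(ACSS.dExch_le_tvDist _ h1 h2).trans h3, fun T hT α hα _ => ?_⟩
  -- The explicit exchangeable law `μ'` is used directly, so the infimum defining `dExch` need not
  -- be approximated.
  have := ACSS.real_setOf_pval_le hm h2 hT hα
  linarith
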